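/- **Theorem (Soundness of Synthesis).** *Syntax.* Fix a datatype context $\Sigma$: finitely many distinct datatypes $D$, each with finitely many constructors $C_i$ of type $T_i\to D$, all constructor names distinct. Types are $T::=T_1\to T_2\mid()\mid T_1\times T_2\mid D$. Expressions are $$e::=\mathsf{fix}\,f(\lambda x.e)\mid e_1\,e_2\mid x\mid()\mid(e_1,e_2)\mid\mathsf{prj}_i\,e\mid C\,e\mid\mathsf{case}\ e\ \mathsf{of}\ \{C_i\,x_i\to e_i\}_i\mid{??}_h ,$$ where ${??}_h$ is a hole named $h$. Results are $$r::=[E]\mathsf{fix}\,f(\lambda x.e)\mid()\mid(r_1,r_2)\mid C\,r\mid[E]{??}_h\mid r_1\,r_2\mid\mathsf{prj}_i\,r\mid[E]\,\mathsf{case}\ r\ \mathsf{of}\ \{C_i\,x_i\to e_i\}_i\mid C^{-1}r ,$$ where an environment $E$ is a list of bindings $x\mapsto r$ (later ones shadow earlier ones). Simple values are $v::=()\mid(v_1,v_2)\mid C\,v$, a subset of the results and of the examples $ex::=()\mid(ex_1,ex_2)\mid C\,ex\mid\{v\to ex\}\mid\top$. A hole filling $F$ is a finite map from holes to expressions. A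 hole context $\Delta$ is a finite map from holes to contextual types $(\Gamma\vdash T)$, where a type context $\Gamma$ is a list of bindings $x:T$. Constraints $K=(F,U)$ consist of a filling and a finite map $U$ from holes to sets $X$ of example constraints $E\vdash ex$; "$-$" is empty. $K_1\oplus K_2$ is the union of the two fillings, defined only if they agree where both are defined, together with the map that takes the union of the sets $X$ hole by hole. On fillings $\oplus$ is likewise this partial union. *Typing.* $\Sigma;\Delta;\Gamma\vdash e:T$ is standard, a $\mathsf{case}$ has exactly one branch for each constructor of the datatype, and ${??}_h$ has type $T$ in context $\Gamma$ iff $\Delta(h)=(\Gamma\vdash T)$. $\Sigma;\Delta\vdash F$ means that for each $h\in\mathrm{dom}\,F$ we have $\Delta(h)=(\Gamma\vdash T)$ with $\Sigma;\Delta;\Gamma\vdash F(h):T$ for some $\Gamma,T$. A program $p$ is $\mathsf{let\ main}=e\ \mathsf{in\ assert}\,(e_1=e_2)$. It is well typed, $\Sigma;\Delta\vdash p:T;T'$, if $\Sigma;\Delta;-\vdash e:T$ and $\Sigma;\Delta;(\mathsf{main}:T)\vdash e_i:T'$ for $i=1,2$. *Evaluation* $E\vdash e\Rightarrow r$ is the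 usual eager big-step environment semantics, except that ${??}_h$ evaluates to $[E]{??}_h$, and an application, projection or case whose principal argument evaluates to $r$ that is not a function closure, a pair, or an application of one of the constructors of the case evaluates to the paused result $r\,r_2$ (the argument having evaluated to $r_2$), $\mathsf{prj}_i\,r$, or $[E]\mathsf{case}\ r\ \mathsf{of}\,\dots$. *Resumption* $F\vdash r\Rightarrow r'$ is the least relation with these rules. $[E]{??}_h$ with $F(h)=e\ne{??}_h$ resumes to whatever the result of evaluating $e$ in $E$ resumes to; if $h\notin\mathrm{dom}\,F$ or $F(h)={??}_h$, only its environment is resumed, binding by binding. Function closures resume their environments, and $()$, pairs and constructor applications resume their components. An application resumes both parts; if the first becomes a function closure, its body is evaluated with the resumed argument and the result is resumed, otherwise the application of the two stays. A projection resumes its argument and then projects if it has become a pair. A case resumes its scrutinee; if this becomes $C_j\,r_0$ for a branch $C_j\,x_j\to e_j$, then $E$ and $r_0$ are resumed to $E'$ and $r_0'$, $e_j$ is evaluated in $E',x_j\mapsto r_0'$ and the result is resumed, otherwise the resumed case closure stays. $C^{-1}r$ becomes $r_0$ if $r$ resumes to $C\,r_0$, and becomes $C^{-1}r'$ if $r$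 resumes to an $r'$ that is not a constructor application. *Live evaluation* of $e$ in $E$ under $F$ is evaluation followed by resumption under $F$. *Final results.* $r$ is final if it is determinate or indeterminate. Determinate are $()$, pairs and constructor applications of final results, and function closures with final environment (all bound results final). Indeterminate are $[E]{??}_h$ with $E$ final, $r_1\,r_2$ with $r_1$ indeterminate and $r_2$ final, $\mathsf{prj}_i\,r$ with $r$ indeterminate, and case closures with final environment and indeterminate scrutinee. *Program evaluation* $p\Rightarrow r;A$ holds if $-\vdash e\Rightarrow r$, $(\mathsf{main}\mapsto r)\vdash e_i\Rightarrow r_i$ for $i=1,2$, and $r_1\equiv_A r_2$. Here $A$ is a finite sequence of assertions $r\Rightarrow v$, and $\equiv_A$ is generated by: $r\equiv_{-}r$; pairs componentwise, with the assertions concatenated; $C\,r\equiv_A C\,r'$ if $r\equiv_A r'$; and $r\equiv_A v$, $v\equiv_A r$ with $A=(r\Rightarrow v)$ for $r$ indeterminate. *Satisfaction*: $F\models A$ means that for each $(r\Rightarrow v)\in A$ we have $F\vdash r\Rightarrow v$. *Checking and unevaluation* (relative to $\Sigma,\Delta$). $F\vdash e\rightleftharpoons\{E_i\vdash ex_i\}_i\dashv\bigoplus_iK_i$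 if $e$ live-evaluates in $E_i$ under $F$ to some $r_i$ with $F\vdash r_i\Leftarrow ex_i\dashv K_i$. The rules for $F\vdash r\Leftarrow ex\dashv K$ are: - $r\Leftarrow\top\dashv-$ and $()\Leftarrow()\dashv-$; pairs componentwise with $K_1\oplus K_2$; $C\,r\Leftarrow C\,ex\dashv K$ if $r\Leftarrow ex\dashv K$. - $[E]\mathsf{fix}\,f(\lambda x.e)\Leftarrow\{v\to ex\}\dashv K$ if $F\vdash e\rightleftharpoons\big(E,f\mapsto[E]\mathsf{fix}\,f(\lambda x.e),x\mapsto v\vdash ex\big)\dashv K$. - $[E]{??}_h\Leftarrow ex\dashv(-,h\mapsto\{E\vdash ex\})$. - $r_1\,v_2\Leftarrow ex\dashv K$ if $r_1\Leftarrow\{v_2\to ex\}\dashv K$, for $v_2$ a simple value. - $\mathsf{prj}_1\,r\Leftarrow ex\dashv K$ if $r\Leftarrow(ex,\top)\dashv K$, and similarly for $\mathsf{prj}_2$; $C^{-1}r\Leftarrow ex\dashv K$ if $r\Leftarrow C\,ex\dashv K$. - $[E]\mathsf{case}\ r\ \mathsf{of}\,\{C_i\,x_i\to e_i\}\Leftarrow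 ex\dashv K_1\oplus K_2$ if for some $j$: $r\Leftarrow C_j\top\dashv K_1$ and $F\vdash e_j\rightleftharpoons(E,x_j\mapsto C_j^{-1}r\vdash ex)\dashv K_2$. - The same case closure unevaluates to $(F',-)\oplus K$ if, for some filling $F'$ with $\Sigma;\Delta\vdash F'$ (chosen arbitrarily) and some $j$: $F\oplus F'\vdash r\Rightarrow C_j\,r'$ and $F\oplus F'\vdash e_j\rightleftharpoons(E,x_j\mapsto r'\vdash ex)\dashv K$. $\mathrm{Simplify}_\Delta(A)=\bigoplus_iK_i$, where for the $i$-th assertion $r_i\Rightarrow v_i$ of $A$ the result $r_i$ is final and $-\vdash r_i\Leftarrow v_i\dashv K_i$. (All these procedures are non-deterministic, and equations such as this one denote relations.) *Merging.* A step takes $(F,U)$ to $(F,-)\oplus\bigoplus_{h\in\mathrm{dom}\,U}K_h$, where $F\vdash F(h)\rightleftharpoons U(h)\dashv K_h$ if $h\in\mathrm{dom}\,F$, and $K_h=(-,h\mapsto U(h))$ otherwise. $\mathrm{Merge}_\Delta(K)=K'$ if $K'$ is reached from $K$ by steps and some step takes $K'$ to itself, all other steps changing the constraints. *Guessing.* $\Gamma\vdash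 T\rightsquigarrow_{\mathrm{guess}}e$ holds for the well-typed expressions $e$ without holes ($\Sigma;-;\Gamma\vdash e:T$). *Hole synthesis* for $h$, given $\Delta,F$, a contextual type $(\Gamma\vdash T)$ and a set $X$, yields constraints and new hole types $\Delta_1$. Let $X^-$ be $X$ without the constraints $E\vdash\top$. "Fresh" holes are distinct and outside $\mathrm{dom}\,\Delta$. The rules are: - *Guess and check*: if $\Gamma\vdash T\rightsquigarrow_{\mathrm{guess}}e$ and $F,h\mapsto e\vdash e\rightleftharpoons X\dashv K$, yield $(h\mapsto e,-)\oplus K$ and $\Delta_1=-$. - *Defer*: if $X\neq\emptyset$ and $X^-=\emptyset$, yield $(h\mapsto{??}_h,-)$ and $\Delta_1=-$. - *Refine*: yield $(h\mapsto e,\{h_i\mapsto X_i\}_i)$ and $\Delta_1=\{h_i\mapsto(\Gamma_i\vdash T_i)\}_i$ with $h_i$ fresh, in one of these ways. (i) $T=()$, all examples in $X^-$ are $()$, $e=()$, no new holes. (ii) $T=T_1\times T_2$, all examples in $X^-$ are pairs, $e=({??}_{h_1},{??}_{h_2})$, $\Gamma_i=\Gamma$, $X_i$ consists of the $i$-th components.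 (iii) $T=D$, $C$ is a constructor $T_1\to D$, all examples in $X^-$ have the form $C\,ex$, $e=C\,{??}_{h_1}$, $\Gamma_1=\Gamma$, $X_1=\{E\vdash ex: (E\vdash C\,ex)\in X^-\}$. (iv) $T=T'\to T''$, all examples in $X^-$ are input-output examples, $e=\mathsf{fix}\,f(\lambda x.{??}_{h_1})$, $\Gamma_1=\Gamma,f:T,x:T'$, $T_1=T''$, $X_1=\{E,f\mapsto[E]e,x\mapsto v\vdash ex: (E\vdash\{v\to ex\})\in X^-\}$. - *Branch*: let $D$ have constructors $C_i:T_i\to D$, let $\Gamma\vdash D\rightsquigarrow_{\mathrm{guess}}e_0$, and for each $E_j\vdash ex_j$ in $X^-$ let $E_j\vdash e_0\Rightarrow r_j$, choose a constructor $\alpha_j$ of $D$, and let $F\vdash e_0\rightleftharpoons(E_j\vdash\alpha_j\top)\dashv K_j$. With $h_i$ fresh, yield $(h\mapsto\mathsf{case}\ e_0\ \mathsf{of}\,\{C_i\,x_i\to{??}_{h_i}\}_i,\ \{h_i\mapsto X_i\}_i)\oplus\bigoplus_jK_j$ and $\Delta_1=\{h_i\mapsto(\Gamma,x_i:T_i\vdash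 T)\}_i$, where $X_i=\{E_j,x_i\mapsto s_{ij}\vdash ex_j:\alpha_j=C_i\}$, with $s_{ij}=r'$ if $r_j=C_i\,r'$ and $s_{ij}=C_i^{-1}r_j$ otherwise. *Solving.* $\mathrm{Solve}_\Delta(K)=(F;\Delta')$ is generated by: $\mathrm{Solve}_\Delta(F,-)=(F;\Delta)$; and $\mathrm{Solve}_\Delta(F,U)=\mathrm{Solve}_{\Delta\cup\Delta_1}(K')$ if, for some $h\in\mathrm{dom}\,U\cap\mathrm{dom}\,\Delta$, hole synthesis for $h$ under $\Delta$, $F$, $\Delta(h)$, $U(h)$ yields $K$ and $\Delta_1$, and $K'=\mathrm{Merge}_{\Delta\cup\Delta_1}\big((F,U\setminus h)\oplus K\big)$. *Statement.* Suppose that $\Sigma;\Delta\vdash p:T;T'$, that $p\Rightarrow r;A$, that $\mathrm{Simplify}_\Delta(A)=K$, and that $\mathrm{Solve}_\Delta(K)=(F;\Delta')$. Then $\Sigma;\Delta'\vdash F$. If, moreover, resumption under $F$ is total on the asserted results, that is, for each $(r_i\Rightarrow v_i)\in A$ there is some $r_i'$ with $F\vdash r_i\Rightarrow r_i'$, then $F\models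 A$: each asserted result $r_i$ resumes under $F$ to the required value $v_i$. -/

import Mathlib

namespace Smyth

/-! Names. Any countably infinite supply of names works, so natural numbers are used. -/

abbrev Var := ℕ
abbrev Con := ℕ
abbrev Dat := ℕ
abbrev Hole := ℕ

/-- The variable `main`, to which the value of a program is bound in its assertion. -/
def mainVar : Var := 0

/-! ## Types, expressions, results -/

inductive Ty : Type
  | arrow : Ty → Ty → Ty
  | unit : Ty
  | prod : Ty → Ty → Ty
  | data : Dat → Ty

/-- The index of a projection. -/
inductive Side : Type
  | one : Side
  | two : Side

mutual
  /-- Expressions (sketches). -/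
  inductive Exp : Type
    | fix : Var → Var → Exp → Exp -- recursive function: own name, parameter, body
    | app : Exp → Exp → Exp
    | var : Var → Exp
    | unit : Exp
    | pair : Exp → Exp → Exp
    | prj : Side → Exp → Exp
    | ctor : Con → Exp → Exp
    | case : Exp → Branches → Exp
    | hole : Hole → Exp
  /-- Lists of branches `C x → e` of a case expression. -/
  inductive Branches : Type
    | nil : Branches
    | cons : Con → Var → Exp → Branches → Branches
end

/-- The branch for the constructor `C`. -/
def Branches.lookup (C : Con) : Branches → Option (Var × Exp)
  | .nil => none
  | .cons C' x e bs => if C = C' then some (x, e) else bs.lookup C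

mutual
  /-- Results. -/
  inductive Res : Type
    | fix : Env → Var → Var → Exp → Res -- function closure
    | unit : Res
    | pair : Res → Res → Res
    | ctor : Con → Res → Res
    | hole : Env → Hole → Res -- hole closure
    | app : Res → Res → Res
    | prj : Side → Res → Res
    | case : Env → Res → Branches → Res -- case closure
    | unwrap : Con → Res → Res -- inverse constructor application
  /-- Environments; the binding added last is the outermost one. -/
  inductive Env : Type
    | nil : Env
    | cons : Env → Var → Res → Env
end

/-- The innermost binding of a variable, that is, the one added last. -/
def Env.lookup (x : Var) : Env → Option Res
  | .nil => none
  | .cons E y r => if x = y then some r else E.lookup x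

/-- Simple values. -/
inductive Val : Type
  | unit : Val
  | pair : Val → Val → Val
  | ctor : Con → Val → Val

/-- Examples. -/
inductive Ex : Type
  | unit : Ex
  | pair : Ex → Ex → Ex
  | ctor : Con → Ex → Ex
  | inOut : Val → Ex → Ex
  | top : Ex

/-- Simple values as results. -/
def Val.toRes : Val → Res
  | .unit => .unit
  | .pair v₁ v₂ => .pair v₁.toRes v₂.toRes
  | .ctor C v => .ctor C v.toRes

/-- Simple values as examples. -/
def Val.toEx : Val → Ex
  | .unit => .unit
  | .pair v₁ v₂ => .pair v₁.toEx v₂.toEx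
  | .ctor C v => .ctor C v.toEx

/-- The partial coercion of results to simple values. -/
inductive Downcast : Res → Val → Prop
  | unit : Downcast .unit .unit
  | pair {r₁ r₂ : Res} {v₁ v₂ : Val} :
      Downcast r₁ v₁ → Downcast r₂ v₂ → Downcast (.pair r₁ r₂) (.pair v₁ v₂)
  | ctor {C : Con} {r : Res} {v : Val} : Downcast r v → Downcast (.ctor C r) (.ctor C v)

mutual
  /-- Final results. -/
  inductive Final : Res → Prop
    | det {r : Res} : Det r → Final r
    | indet {r : Res} : Indet r → Final r
  /-- Final environments. -/
  inductive FinalEnv : Env → Prop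
    | nil : FinalEnv .nil
    | cons {E : Env} {x : Var} {r : Res} : FinalEnv E → Final r → FinalEnv (.cons E x r)
  /-- Determinate results. -/
  inductive Det : Res → Prop
    | unit : Det .unit
    | pair {r₁ r₂ : Res} : Final r₁ → Final r₂ → Det (.pair r₁ r₂)
    | ctor {C : Con} {r : Res} : Final r → Det (.ctor C r)
    | fix {E : Env} {f x : Var} {e : Exp} : FinalEnv E → Det (.fix E f x e)
  /-- Indeterminate results. -/
  inductive Indet : Res → Prop
    | hole {E : Env} {h : Hole} : FinalEnv E → Indet (.hole E h)
    | app {r₁ r₂ : Res} : Indet r₁ → Final r₂ → Indet (.app r₁ r₂)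
    | prj {i : Side} {r : Res} : Indet r → Indet (.prj i r)
    | case {E : Env} {r : Res} {bs : Branches} :
        FinalEnv E → Indet r → Indet (.case E r bs)
end

/-! ## Contexts and expression typing -/

/-- Datatype contexts: each datatype comes with the list of its constructors, each of which
takes one argument. Datatypes are declared once, and so are constructors. -/
structure DataCtx : Type where
  decls : List (Dat × List (Con × Ty))
  nodup_dat : (decls.map Prod.fst).Nodup
  nodup_con : (decls.flatMap fun d => d.2.map Prod.fst).Nodup

/-- The datatype `D` is declared with the constructors `cs`. -/
def DataCtx.HasData (S : DataCtx) (D : Dat) (cs : List (Con × Ty)) : Prop :=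
  (D, cs) ∈ S.decls

/-- The constructor `C` has type `T → D`. -/
def DataCtx.HasCtor (S : DataCtx) (C : Con) (T : Ty) (D : Dat) : Prop :=
  ∃ cs, S.HasData D cs ∧ (C, T) ∈ cs

/-- Type contexts; the binding added last stands first. -/
abbrev Ctx := List (Var × Ty)

/-- Hole type contexts: finite maps from holes to contextual types. -/
abbrev HoleCtx := Finmap (fun _ : Hole => Ctx × Ty)

/-- Hole fillings: finite maps from holes to expressions. -/
abbrev Filling := Finmap (fun _ : Hole => Exp)

mutual
  /-- Expression typing. -/
  inductive HasTy (S : DataCtx) (Δ : HoleCtx) : Ctx → Exp → Ty → Prop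
    | fix {Γ : Ctx} {f x : Var} {e : Exp} {T₁ T₂ : Ty} :
        HasTy S Δ ((x, T₁) :: (f, .arrow T₁ T₂) :: Γ) e T₂ →
        HasTy S Δ Γ (.fix f x e) (.arrow T₁ T₂)
    | var {Γ : Ctx} {x : Var} {T : Ty} : Γ.lookup x = some T → HasTy S Δ Γ (.var x) T
    | hole {Γ : Ctx} {h : Hole} {T : Ty} :
        Δ.lookup h = some (Γ, T) → HasTy S Δ Γ (.hole h) T
    | unit {Γ : Ctx} : HasTy S Δ Γ .unit .unit
    | pair {Γ : Ctx} {e₁ e₂ : Exp} {T₁ T₂ : Ty} :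
        HasTy S Δ Γ e₁ T₁ → HasTy S Δ Γ e₂ T₂ → HasTy S Δ Γ (.pair e₁ e₂) (.prod T₁ T₂)
    | ctor {Γ : Ctx} {C : Con} {e : Exp} {T : Ty} {D : Dat} :
        S.HasCtor C T D → HasTy S Δ Γ e T → HasTy S Δ Γ (.ctor C e) (.data D)
    | app {Γ : Ctx} {e₁ e₂ : Exp} {T₂ T : Ty} :
        HasTy S Δ Γ e₁ (.arrow T₂ T) → HasTy S Δ Γ e₂ T₂ → HasTy S Δ Γ (.app e₁ e₂) T
    | prj_one {Γ : Ctx} {e : Exp} {T₁ T₂ : Ty} :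
        HasTy S Δ Γ e (.prod T₁ T₂) → HasTy S Δ Γ (.prj .one e) T₁
    | prj_two {Γ : Ctx} {e : Exp} {T₁ T₂ : Ty} :
        HasTy S Δ Γ e (.prod T₁ T₂) → HasTy S Δ Γ (.prj .two e) T₂
    | case {Γ : Ctx} {e : Exp} {bs : Branches} {D : Dat} {cs : List (Con × Ty)} {T : Ty} :
        HasTy S Δ Γ e (.data D) → S.HasData D cs → BranchesTy S Δ Γ T cs bs →
        HasTy S Δ Γ (.case e bs) T
  /-- Typing of branches: exactly one branch for each of the listed constructors. -/
  inductive BranchesTy (S : DataCtx) (Δ : HoleCtx) :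
      Ctx → Ty → List (Con × Ty) → Branches → Prop
    | nil {Γ : Ctx} {T : Ty} : BranchesTy S Δ Γ T [] .nil
    | cons {Γ : Ctx} {T : Ty} {C : Con} {T₁ : Ty} {cs : List (Con × Ty)} {x : Var} {e : Exp}
        {bs : Branches} :
        HasTy S Δ ((x, T₁) :: Γ) e T → BranchesTy S Δ Γ T cs bs →
        BranchesTy S Δ Γ T ((C, T₁) :: cs) (.cons C x e bs)
end

/-- A hole filling is well typed. -/
def FillingTy (S : DataCtx) (Δ : HoleCtx) (F : Filling) : Prop :=
  ∀ h e, F.lookup h = some e → ∃ Γ T, Δ.lookup h = some (Γ, T) ∧ HasTy S Δ Γ e T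

/-! ## Evaluation and resumption -/

/-- Expression evaluation `E ⊢ e ⇒ r`. -/
inductive Eval : Env → Exp → Res → Prop
  | hole {E : Env} {h : Hole} : Eval E (.hole h) (.hole E h)
  | fix {E : Env} {f x : Var} {e : Exp} : Eval E (.fix f x e) (.fix E f x e)
  | var {E : Env} {x : Var} {r : Res} : E.lookup x = some r → Eval E (.var x) r
  | unit {E : Env} : Eval E .unit .unit
  | pair {E : Env} {e₁ e₂ : Exp} {r₁ r₂ : Res} :
      Eval E e₁ r₁ → Eval E e₂ r₂ → Eval E (.pair e₁ e₂) (.pair r₁ r₂)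
  | ctor {E : Env} {C : Con} {e : Exp} {r : Res} :
      Eval E e r → Eval E (.ctor C e) (.ctor C r)
  | app {E Ef : Env} {e₁ e₂ ef : Exp} {f x : Var} {r₂ r : Res} :
      Eval E e₁ (.fix Ef f x ef) → Eval E e₂ r₂ →
      Eval (.cons (.cons Ef f (.fix Ef f x ef)) x r₂) ef r →
      Eval E (.app e₁ e₂) r
  | app_indet {E : Env} {e₁ e₂ : Exp} {r₁ r₂ : Res} :
      Eval E e₁ r₁ → Eval E e₂ r₂ → (∀ Ef f x ef, r₁ ≠ .fix Ef f x ef) →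
      Eval E (.app e₁ e₂) (.app r₁ r₂)
  | prj_one {E : Env} {e : Exp} {r₁ r₂ : Res} :
      Eval E e (.pair r₁ r₂) → Eval E (.prj .one e) r₁
  | prj_two {E : Env} {e : Exp} {r₁ r₂ : Res} :
      Eval E e (.pair r₁ r₂) → Eval E (.prj .two e) r₂
  | prj_indet {E : Env} {i : Side} {e : Exp} {r : Res} :
      Eval E e r → (∀ r₁ r₂, r ≠ .pair r₁ r₂) → Eval E (.prj i e) (.prj i r)
  | case {E : Env} {e ej : Exp} {bs : Branches} {C : Con} {x : Var} {r rj : Res} :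
      Eval E e (.ctor C r) → bs.lookup C = some (x, ej) → Eval (.cons E x r) ej rj →
      Eval E (.case e bs) rj
  | case_indet {E : Env} {e : Exp} {bs : Branches} {r : Res} :
      Eval E e r → (∀ C r₀, r = .ctor C r₀ → bs.lookup C = none) →
      Eval E (.case e bs) (.case E r bs)

mutual
  /-- Resumption `F ⊢ r ⇒ r'`. In the rule `case`, the selected branch is resumed as the
  application of the non-recursive function closure `[E] (λ x. e)` to the argument `r₀`. -/
  inductive Resume (F : Filling) : Res → Res → Prop
    | hole {E : Env} {h : Hole} {e : Exp} {r r' : Res} :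
        F.lookup h = some e → e ≠ .hole h → Eval E e r → Resume F r r' →
        Resume F (.hole E h) r'
    | hole_indet {E E' : Env} {h : Hole} :
        (F.lookup h = none ∨ F.lookup h = some (.hole h)) → ResumeEnv F E E' →
        Resume F (.hole E h) (.hole E' h)
    | fix {E E' : Env} {f x : Var} {e : Exp} :
        ResumeEnv F E E' → Resume F (.fix E f x e) (.fix E' f x e)
    | unit : Resume F .unit .unit
    | pair {r₁ r₂ r₁' r₂' : Res} :
        Resume F r₁ r₁' → Resume F r₂ r₂' → Resume F (.pair r₁ r₂) (.pair r₁' r₂')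
    | ctor {C : Con} {r r' : Res} : Resume F r r' → Resume F (.ctor C r) (.ctor C r')
    | app {r₁ r₂ r₂' r r' : Res} {Ef : Env} {f x : Var} {ef : Exp} :
        Resume F r₁ (.fix Ef f x ef) → Resume F r₂ r₂' →
        Eval (.cons (.cons Ef f (.fix Ef f x ef)) x r₂') ef r → Resume F r r' →
        Resume F (.app r₁ r₂) r'
    | app_indet {r₁ r₂ r₁' r₂' : Res} :
        Resume F r₁ r₁' → Resume F r₂ r₂' → (∀ Ef f x ef, r₁' ≠ .fix Ef f x ef) →
        Resume F (.app r₁ r₂) (.app r₁' r₂')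
    | prj_one {r r₁ r₂ : Res} : Resume F r (.pair r₁ r₂) → Resume F (.prj .one r) r₁
    | prj_two {r r₁ r₂ : Res} : Resume F r (.pair r₁ r₂) → Resume F (.prj .two r) r₂
    | prj_indet {i : Side} {r r' : Res} :
        Resume F r r' → (∀ r₁ r₂, r' ≠ .pair r₁ r₂) → Resume F (.prj i r) (.prj i r')
    | case {E E' : Env} {r r₀ r₀' r₁ r' : Res} {bs : Branches} {C : Con} {x : Var} {e : Exp} :
        Resume F r (.ctor C r₀) → bs.lookup C = some (x, e) →
        ResumeEnv F E E' → Resume F r₀ r₀' → Eval (.cons E' x r₀') e r₁ → Resume F r₁ r' →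
        Resume F (.case E r bs) r'
    | case_indet {E E' : Env} {r r' : Res} {bs : Branches} :
        Resume F r r' → (∀ C r₀, r' = .ctor C r₀ → bs.lookup C = none) →
        ResumeEnv F E E' → Resume F (.case E r bs) (.case E' r' bs)
    | unwrap {C : Con} {r r' : Res} : Resume F r (.ctor C r') → Resume F (.unwrap C r) r'
    | unwrap_indet {C : Con} {r r' : Res} :
        Resume F r r' → (∀ C' r₀, r' ≠ .ctor C' r₀) →
        Resume F (.unwrap C r) (.unwrap C r')
  /-- Environment resumption. -/
  inductive ResumeEnv (F : Filling) : Env → Env → Prop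
    | nil : ResumeEnv F .nil .nil
    | cons {E E' : Env} {x : Var} {r r' : Res} :
        ResumeEnv F E E' → Resume F r r' → ResumeEnv F (.cons E x r) (.cons E' x r')
end

/-- Live evaluation: evaluation followed by resumption. -/
def LiveEval (E : Env) (F : Filling) (e : Exp) (r' : Res) : Prop :=
  ∃ r, Eval E e r ∧ Resume F r r'

/-! ## Constraints and their syntactic merging -/

/-- Example constraints: an environment and an example. -/
abbrev World := Env × Ex

/-- Unfilled holes: a finite map from holes to sets of example constraints. -/
abbrev Unfilled := Finmap (fun _ : Hole => Set World)

/-- Unevaluation constraints. -/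
structure Constraints : Type where
  fill : Filling
  unf : Unfilled

/-- The empty constraints. -/
def Constraints.empty : Constraints := ⟨∅, ∅⟩

/-- `F₁ ⊕ F₂ = F`. -/
def MergeFill (F₁ F₂ F : Filling) : Prop :=
  (∀ h e₁ e₂, F₁.lookup h = some e₁ → F₂.lookup h = some e₂ → e₁ = e₂) ∧ F = F₁ ∪ F₂

/-- The union of two sets of example constraints, each of which may be missing. -/
def unionWorlds : Option (Set World) → Option (Set World) → Option (Set World)
  | some X₁, some X₂ => some (X₁ ∪ X₂)
  | some X₁, none => some X₁
  | none, o => o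

/-- `U₁ ⊕ U₂ = U`. -/
def MergeUnf (U₁ U₂ U : Unfilled) : Prop :=
  ∀ h, U.lookup h = unionWorlds (U₁.lookup h) (U₂.lookup h)

/-- `K₁ ⊕ K₂ = K`. -/
def MergeK (K₁ K₂ K : Constraints) : Prop :=
  MergeFill K₁.fill K₂.fill K.fill ∧ MergeUnf K₁.unf K₂.unf K.unf

/-- `K₁ ⊕ ⋯ ⊕ Kₙ = K`. -/
inductive MergeList : List Constraints → Constraints → Prop
  | nil : MergeList [] .empty
  | cons {K K' K'' : Constraints} {Ks : List Constraints} :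
      MergeList Ks K' → MergeK K K' K'' → MergeList (K :: Ks) K''

/-! ## Live unevaluation and live bidirectional example checking -/

/-- The fillings that may be guessed in order to resume a scrutinee `r`: a guess is an arbitrary
well-typed hole filling, chosen non-deterministically. -/
def Guesses (S : DataCtx) (Δ : HoleCtx) (_r : Res) (F' : Filling) : Prop :=
  FillingTy S Δ F'

mutual
  /-- Live unevaluation `F ⊢ r ⇐ ex ⊣ K`. -/
  inductive Uneval (S : DataCtx) (Δ : HoleCtx) : Filling → Res → Ex → Constraints → Prop
    | top {F : Filling} {r : Res} : Uneval S Δ F r .top .empty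
    | unit {F : Filling} : Uneval S Δ F .unit .unit .empty
    | pair {F : Filling} {r₁ r₂ : Res} {ex₁ ex₂ : Ex} {K₁ K₂ K : Constraints} :
        Uneval S Δ F r₁ ex₁ K₁ → Uneval S Δ F r₂ ex₂ K₂ → MergeK K₁ K₂ K →
        Uneval S Δ F (.pair r₁ r₂) (.pair ex₁ ex₂) K
    | ctor {F : Filling} {C : Con} {r : Res} {ex : Ex} {K : Constraints} :
        Uneval S Δ F r ex K → Uneval S Δ F (.ctor C r) (.ctor C ex) K
    | fix {F : Filling} {E : Env} {f x : Var} {e : Exp} {v : Val} {ex : Ex} {K : Constraints} :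
        Check S Δ F e [(.cons (.cons E f (.fix E f x e)) x v.toRes, ex)] K →
        Uneval S Δ F (.fix E f x e) (.inOut v ex) K
    | hole {F : Filling} {E : Env} {h : Hole} {ex : Ex} :
        Uneval S Δ F (.hole E h) ex ⟨∅, Finmap.singleton h {(E, ex)}⟩
    | app {F : Filling} {r₁ r₂ : Res} {v₂ : Val} {ex : Ex} {K : Constraints} :
        Downcast r₂ v₂ → Uneval S Δ F r₁ (.inOut v₂ ex) K → Uneval S Δ F (.app r₁ r₂) ex K
    | prj_one {F : Filling} {r : Res} {ex : Ex} {K : Constraints} :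
        Uneval S Δ F r (.pair ex .top) K → Uneval S Δ F (.prj .one r) ex K
    | prj_two {F : Filling} {r : Res} {ex : Ex} {K : Constraints} :
        Uneval S Δ F r (.pair .top ex) K → Uneval S Δ F (.prj .two r) ex K
    | case {F : Filling} {E : Env} {r : Res} {bs : Branches} {C : Con} {x : Var} {e : Exp}
        {ex : Ex} {K₁ K₂ K : Constraints} :
        bs.lookup C = some (x, e) → Uneval S Δ F r (.ctor C .top) K₁ →
        Check S Δ F e [(.cons E x (.unwrap C r), ex)] K₂ → MergeK K₁ K₂ K →
        Uneval S Δ F (.case E r bs) ex K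
    | unwrap {F : Filling} {C : Con} {r : Res} {ex : Ex} {K : Constraints} :
        Uneval S Δ F r (.ctor C ex) K → Uneval S Δ F (.unwrap C r) ex K
    | case_guess {F F' F'' : Filling} {E : Env} {r r' : Res} {bs : Branches} {C : Con} {x : Var}
        {e : Exp} {ex : Ex} {K K' : Constraints} :
        bs.lookup C = some (x, e) → Guesses S Δ r F' → MergeFill F F' F'' →
        Resume F'' r (.ctor C r') → Check S Δ F'' e [(.cons E x r', ex)] K →
        MergeK ⟨F', ∅⟩ K K' →
        Uneval S Δ F (.case E r bs) ex K'
  /-- Live bidirectional example checking `F ⊢ e ⇌ (E₁ ⊢ ex₁, …, Eₙ ⊢ exₙ) ⊣ K₁ ⊕ ⋯ ⊕ Kₙ`. -/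
  inductive Check (S : DataCtx) (Δ : HoleCtx) :
      Filling → Exp → List World → Constraints → Prop
    | nil {F : Filling} {e : Exp} : Check S Δ F e [] .empty
    | cons {F : Filling} {e : Exp} {E : Env} {ex : Ex} {r : Res} {ws : List World}
        {K K' K'' : Constraints} :
        LiveEval E F e r → Uneval S Δ F r ex K → Check S Δ F e ws K' → MergeK K K' K'' →
        Check S Δ F e ((E, ex) :: ws) K''
end

/-- Live bidirectional example checking against a set of example constraints. -/
def CheckSet (S : DataCtx) (Δ : HoleCtx) (F : Filling) (e : Exp) (X : Set World)
    (K : Constraints) : Prop :=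
  ∃ ws : List World, X = {w | w ∈ ws} ∧ Check S Δ F e ws K

/-! ## Semantic merging -/

/-- Resolution of the example constraints `X` on the hole `h` under the filling `F`. -/
inductive Resolve (S : DataCtx) (Δ : HoleCtx) (F : Filling) :
    Hole → Set World → Constraints → Prop
  | filled {h : Hole} {X : Set World} {e : Exp} {K : Constraints} :
      F.lookup h = some e → CheckSet S Δ F e X K → Resolve S Δ F h X K
  | unfilled {h : Hole} {X : Set World} :
      F.lookup h = none → Resolve S Δ F h X ⟨∅, Finmap.singleton h X⟩

/-- One step of semantic merging: every entry of the unfilled holes is resolved. -/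
def StepMerge (S : DataCtx) (Δ : HoleCtx) (K K' : Constraints) : Prop :=
  ∃ (hs : List Hole) (Ks : List Constraints) (K₀ : Constraints),
    hs.Nodup ∧ (∀ h, h ∈ hs ↔ h ∈ K.unf) ∧
    List.Forall₂
      (fun h Kh => ∃ X, K.unf.lookup h = some X ∧ Resolve S Δ K.fill h X Kh) hs Ks ∧
    MergeList Ks K₀ ∧ MergeK ⟨K.fill, ∅⟩ K₀ K'

/-- Semantic merging: steps are iterated until nothing changes. -/
inductive Merge (S : DataCtx) (Δ : HoleCtx) : Constraints → Constraints → Prop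
  | step {K K' K'' : Constraints} :
      StepMerge S Δ K K' → K ≠ K' → Merge S Δ K' K'' → Merge S Δ K K''
  | done {K K' : Constraints} : StepMerge S Δ K K' → K = K' → Merge S Δ K K'

/-! ## Guessing, refinement, branching -/

mutual
  /-- Type-directed guessing of expressions without holes. -/
  inductive Guess (S : DataCtx) : Ctx → Ty → Exp → Prop
    | unit {Γ : Ctx} : Guess S Γ .unit .unit
    | pair {Γ : Ctx} {T₁ T₂ : Ty} {e₁ e₂ : Exp} :
        Guess S Γ T₁ e₁ → Guess S Γ T₂ e₂ → Guess S Γ (.prod T₁ T₂) (.pair e₁ e₂)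
    | ctor {Γ : Ctx} {C : Con} {T : Ty} {D : Dat} {e : Exp} :
        S.HasCtor C T D → Guess S Γ T e → Guess S Γ (.data D) (.ctor C e)
    | fix {Γ : Ctx} {f x : Var} {T₁ T₂ : Ty} {e : Exp} :
        Guess S ((x, T₁) :: (f, .arrow T₁ T₂) :: Γ) T₂ e →
        Guess S Γ (.arrow T₁ T₂) (.fix f x e)
    | case {Γ : Ctx} {T : Ty} {D : Dat} {cs : List (Con × Ty)} {e : Exp} {bs : Branches} :
        S.HasData D cs → Guess S Γ (.data D) e → GuessBranches S Γ T cs bs →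
        Guess S Γ T (.case e bs)
    | var {Γ : Ctx} {x : Var} {T : Ty} : Γ.lookup x = some T → Guess S Γ T (.var x)
    | app {Γ : Ctx} {T₂ T : Ty} {e₁ e₂ : Exp} :
        Guess S Γ (.arrow T₂ T) e₁ → Guess S Γ T₂ e₂ → Guess S Γ T (.app e₁ e₂)
    | prj_one {Γ : Ctx} {T₁ T₂ : Ty} {e : Exp} :
        Guess S Γ (.prod T₁ T₂) e → Guess S Γ T₁ (.prj .one e)
    | prj_two {Γ : Ctx} {T₁ T₂ : Ty} {e : Exp} :
        Guess S Γ (.prod T₁ T₂) e → Guess S Γ T₂ (.prj .two e)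
  /-- Guessing of one branch for each of the listed constructors. -/
  inductive GuessBranches (S : DataCtx) : Ctx → Ty → List (Con × Ty) → Branches → Prop
    | nil {Γ : Ctx} {T : Ty} : GuessBranches S Γ T [] .nil
    | cons {Γ : Ctx} {T : Ty} {C : Con} {T₁ : Ty} {cs : List (Con × Ty)} {x : Var} {e : Exp}
        {bs : Branches} :
        Guess S ((x, T₁) :: Γ) T e → GuessBranches S Γ T cs bs →
        GuessBranches S Γ T ((C, T₁) :: cs) (.cons C x e bs)
end

/-- Synthesis goals. -/
structure Goal : Type where
  hole : Hole
  ctx : Ctx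
  ty : Ty
  worlds : Set World

/-- Removal of the constraints that carry the example top. -/
def filterTop (X : Set World) : Set World := {w ∈ X | w.2 ≠ .top}

/-- Refinement. A hole is fresh if the current hole type context does not mention it. -/
inductive Refine (S : DataCtx) (Δ : HoleCtx) :
    Ctx → Set World → Ty → Exp → List Goal → Prop
  | unit {Γ : Ctx} {X : Set World} :
      (∀ w ∈ filterTop X, w.2 = .unit) → Refine S Δ Γ X .unit .unit []
  | pair {Γ : Ctx} {X : Set World} {T₁ T₂ : Ty} {h₁ h₂ : Hole} :
      (∀ w ∈ filterTop X, ∃ ex₁ ex₂, w.2 = .pair ex₁ ex₂) →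
      h₁ ∉ Δ → h₂ ∉ Δ → h₁ ≠ h₂ →
      Refine S Δ Γ X (.prod T₁ T₂) (.pair (.hole h₁) (.hole h₂))
        [⟨h₁, Γ, T₁, {w | ∃ ex₂, (w.1, Ex.pair w.2 ex₂) ∈ filterTop X}⟩,
         ⟨h₂, Γ, T₂, {w | ∃ ex₁, (w.1, Ex.pair ex₁ w.2) ∈ filterTop X}⟩]
  | ctor {Γ : Ctx} {X : Set World} {C : Con} {T : Ty} {D : Dat} {h₁ : Hole} :
      (∀ w ∈ filterTop X, ∃ ex, w.2 = .ctor C ex) → S.HasCtor C T D → h₁ ∉ Δ →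
      Refine S Δ Γ X (.data D) (.ctor C (.hole h₁))
        [⟨h₁, Γ, T, {w | (w.1, Ex.ctor C w.2) ∈ filterTop X}⟩]
  | fix {Γ : Ctx} {X : Set World} {T₁ T₂ : Ty} {f x : Var} {h₁ : Hole} :
      (∀ w ∈ filterTop X, ∃ v ex, w.2 = .inOut v ex) → h₁ ∉ Δ →
      Refine S Δ Γ X (.arrow T₁ T₂) (.fix f x (.hole h₁))
        [⟨h₁, (x, T₁) :: (f, .arrow T₁ T₂) :: Γ, T₂,
          {w | ∃ E v, (E, Ex.inOut v w.2) ∈ filterTop X ∧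
            w.1 = .cons (.cons E f (.fix E f x (.hole h₁))) x v.toRes}⟩]

/-- Constructor simplification: an inverse constructor application cancels the constructor. -/
def collapse : Res → Res
  | .unwrap C (.ctor C' r) => if C = C' then r else .unwrap C (.ctor C' r)
  | r => r

/-- The data of one branch created by branching: a constructor with its argument type, the
variable bound by the branch, and the hole that is its body. -/
structure BranchSpec : Type where
  con : Con
  ty : Ty
  var : Var
  hole : Hole

/-- The branches `C₁ x₁ → ??h₁, …, Cₙ xₙ → ??hₙ`. -/
def holeBranches : List BranchSpec → Branches
  | [] => .nil
  | b :: bs => .cons b.con b.var (.hole b.hole) (holeBranches bs)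

/-- An example constraint `env ⊢ ex` distributed by branching, together with the result of the
scrutinee in `env` and the constructor chosen for it. -/
structure Distributed : Type where
  env : Env
  ex : Ex
  res : Res
  con : Con

/-- Branching. -/
inductive Branch (S : DataCtx) (Δ : HoleCtx) (F : Filling) :
    Ctx → Set World → Ty → Exp → List Goal → Constraints → Prop
  | case {Γ : Ctx} {X : Set World} {T : Ty} {e : Exp} {D : Dat} {cs : List (Con × Ty)}
      {ds : List Distributed} {Ks : List Constraints} {K : Constraints}
      {bs : List BranchSpec} :
      S.HasData D cs → Guess S Γ (.data D) e →
      filterTop X = {w | ∃ d ∈ ds, w = (d.env, d.ex)} →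
      List.Forall₂
        (fun d Kd => Eval d.env e d.res ∧ d.con ∈ cs.map Prod.fst ∧
          Check S Δ F e [(d.env, .ctor d.con .top)] Kd) ds Ks →
      MergeList Ks K →
      bs.map (fun b => (b.con, b.ty)) = cs →
      (∀ b ∈ bs, b.hole ∉ Δ) → (bs.map BranchSpec.hole).Nodup →
      Branch S Δ F Γ X T (.case e (holeBranches bs))
        (bs.map fun b =>
          ⟨b.hole, (b.var, b.ty) :: Γ, T,
            {w | ∃ d ∈ ds, d.con = b.con ∧
              w = (.cons d.env b.var (collapse (.unwrap b.con d.res)), d.ex)}⟩)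
        K


/-! ## Hole synthesis and constraint solving -/

/-- The unfilled holes described by a list of goals. -/
def goalsUnf (G : List Goal) : Unfilled :=
  (G.map fun g => (⟨g.hole, g.worlds⟩ : Sigma fun _ : Hole => Set World)).toFinmap

/-- The hole type context described by a list of goals. -/
def goalsCtx (G : List Goal) : HoleCtx :=
  (G.map fun g => (⟨g.hole, (g.ctx, g.ty)⟩ : Sigma fun _ : Hole => Ctx × Ty)).toFinmap

/-- Hole synthesis: the goal is the hole `h` with its contextual type and its example constraints,
the outputs are constraints and the types of the holes that were created. -/
inductive Fill (S : DataCtx) (Δ : HoleCtx) (h : Hole) (F : Filling) :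
    Ctx → Set World → Ty → Constraints → HoleCtx → Prop
  | guess_and_check {Γ : Ctx} {X : Set World} {T : Ty} {e : Exp} {K K' : Constraints} :
      Guess S Γ T e → CheckSet S Δ (F.insert h e) e X K →
      MergeK ⟨Finmap.singleton h e, ∅⟩ K K' →
      Fill S Δ h F Γ X T K' ∅
  | defer {Γ : Ctx} {X : Set World} {T : Ty} :
      X.Nonempty → (∀ w ∈ X, w.2 = .top) →
      Fill S Δ h F Γ X T ⟨Finmap.singleton h (.hole h), ∅⟩ ∅
  | refine {Γ : Ctx} {X : Set World} {T : Ty} {e : Exp} {G : List Goal} :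
      Refine S Δ Γ X T e G →
      Fill S Δ h F Γ X T ⟨Finmap.singleton h e, goalsUnf G⟩ (goalsCtx G)
  | branch {Γ : Ctx} {X : Set World} {T : Ty} {e : Exp} {G : List Goal} {K K' : Constraints} :
      Branch S Δ F Γ X T e G K →
      MergeK ⟨Finmap.singleton h e, goalsUnf G⟩ K K' →
      Fill S Δ h F Γ X T K' (goalsCtx G)

/-- Constraint solving `Δ; Σ ⊢ Solve(K) ⇝ F; Δ'`. -/
inductive Solve (S : DataCtx) : HoleCtx → Constraints → Filling → HoleCtx → Prop
  | done {Δ : HoleCtx} {F : Filling} : Solve S Δ ⟨F, ∅⟩ F Δ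
  | one {Δ Δ' Δ'' : HoleCtx} {F F' : Filling} {U : Unfilled} {h : Hole} {Γ : Ctx} {T : Ty}
      {X : Set World} {K K₀ K' : Constraints} :
      Δ.lookup h = some (Γ, T) → U.lookup h = some X →
      Fill S Δ h F Γ X T K Δ' →
      MergeK ⟨F, U.erase h⟩ K K₀ → Merge S (Δ ∪ Δ') K₀ K' →
      Solve S (Δ ∪ Δ') K' F' Δ'' →
      Solve S Δ ⟨F, U⟩ F' Δ''

/-! ## Programs and assertions -/

/-- A program `let main = body in assert (left = right)`. -/
structure Program : Type where
  body : Exp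
  left : Exp
  right : Exp

/-- Program typing; `T` is the type of the body, `T'` that of the two sides of the assertion. -/
def ProgramTy (S : DataCtx) (Δ : HoleCtx) (p : Program) (T T' : Ty) : Prop :=
  HasTy S Δ [] p.body T ∧ HasTy S Δ [(mainVar, T)] p.left T' ∧
    HasTy S Δ [(mainVar, T)] p.right T'

/-- Assertions: finite sequences of pairs of a result and the simple value required of it. -/
abbrev Assertions := List (Res × Val)

/-- Result consistency `r ≡_A r'`. -/
inductive Consistent : Res → Res → Assertions → Prop
  | refl {r : Res} : Consistent r r []
  | pair {r₁ r₂ r₁' r₂' : Res} {A₁ A₂ : Assertions} :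
      Consistent r₁ r₁' A₁ → Consistent r₂ r₂' A₂ →
      Consistent (.pair r₁ r₂) (.pair r₁' r₂') (A₁ ++ A₂)
  | ctor {C : Con} {r r' : Res} {A : Assertions} :
      Consistent r r' A → Consistent (.ctor C r) (.ctor C r') A
  | assert_left {r₁ r₂ : Res} {v₂ : Val} :
      Indet r₁ → Downcast r₂ v₂ → Consistent r₁ r₂ [(r₁, v₂)]
  | assert_right {r₁ r₂ : Res} {v₁ : Val} :
      Downcast r₁ v₁ → Indet r₂ → Consistent r₁ r₂ [(r₂, v₁)]

/-- Program evaluation: `p` evaluates to `r` and produces the assertions `A`. -/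
def ProgramEval (p : Program) (r : Res) (A : Assertions) : Prop :=
  Eval .nil p.body r ∧ ∃ r₁ r₂, Eval (.cons .nil mainVar r) p.left r₁ ∧
    Eval (.cons .nil mainVar r) p.right r₂ ∧ Consistent r₁ r₂ A

/-- Assertion simplification. -/
def Simplify (S : DataCtx) (Δ : HoleCtx) (A : Assertions) (K : Constraints) : Prop :=
  ∃ Ks : List Constraints,
    List.Forall₂ (fun a Ka => Final a.1 ∧ Uneval S Δ ∅ a.1 a.2.toEx Ka) A Ks ∧ MergeList Ks K

/-- Assertion satisfaction. -/
def AssertionSat (F : Filling) (A : Assertions) : Prop :=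
  ∀ a ∈ A, ∃ r', Resume F a.1 r' ∧ Downcast r' a.2

/-- Resumption under `F` is total on the asserted results: each of them resumes to some result,
about which nothing is said. -/
def ResumptionTotal (F : Filling) (A : Assertions) : Prop :=
  ∀ a ∈ A, ∃ r', Resume F a.1 r'

end Smyth

open Smyth

namespace Smyth

/-! ## A filter model

Expressions and results denote sets of finite observations, called tokens. The hole filling is
unfolded on demand, constructors and pairs are lazy, and diverging or stuck computations denote
the empty set. -/

-- Everything is read in a model in which a hole denotes whatever the final filling `F` puts there.
-- Checks run under intermediate fillings `G` and on results that are only partly resumed, but the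
-- model does not see the difference: evaluation preserves denotations (`Eval.den_eq`), and
-- resumption under any `G` that `F` extends preserves denotations under `F` (`Resume.den_eq`). This
-- replaces any argument about confluence or termination of resumption. Pairs and constructors are
-- lazy because a component may be paused and denote the empty set, while projecting a pair or
-- unwrapping a constructor must still return the component exactly.
--
-- An example becomes a monotone property `Sat` of denotations. Each procedure is then sound
-- backwards: if `F` satisfies the constraints it outputs, `F` satisfies what it was asked for
-- (`Uneval.sound`, `Check.sound`, `Merge.sound`, `Fill.sound`). Solving stops at the filling `F`
-- with no unfilled holes, constraints that `F` satisfies trivially. Going back along the run, `F`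
-- satisfies the initial constraints (`Solve.sound`), so the denotation of each asserted result
-- satisfies its required value (`Simplify.sound`).
--
-- To return to the operational statement, note that the outcome of a resumption under `F` either is
-- headed by an introduction form or denotes the empty set (`Resume.resumed`). Hence an outcome
-- whose denotation satisfies a simple value is that value, layer by layer (`Resumed.downcast`).
-- Totality is needed at this point only: a lazy denotation may contain tokens although eager
-- resumption diverges.
--
-- Typing is a separate induction (`Solve.fillingTy`): fillings come from typed guesses or from hole
-- synthesis, and hole contexts only grow, by fresh names.

/-- Finite observations of a result. -/
inductive Token : Type
  | unit : Token
  | isPair : Token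
  | comp : Side → Token → Token
  | isCtor : Con → Token
  | arg : Con → Token → Token
  | arr : List Token → Token → Token

/-- Semantic environments. -/
abbrev Interp := Var → Set Token

/-- The set of the elements of a list of tokens. -/
def ofList (L : List Token) : Set Token := {a | a ∈ L}

/-- Token assignment `ρ ⊢ e : a`, relative to a hole filling. -/
inductive Den (F : Filling) : Interp → Exp → Token → Prop
  -- `Φ` holds the finitely many tokens of the function itself that the body uses in recursive
  -- calls. They are derived beforehand, so the inductive definition yields the least fixed point.
  -- Finite lists stand in for whole denotations, which would not be strictly positive here.
  | fix {ρ : Interp} {f x : Var} {e : Exp} {Φ A : List Token} {b : Token} :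
      (∀ t ∈ Φ, Den F ρ (.fix f x e) t) →
      Den F (Function.update (Function.update ρ f (ofList Φ)) x (ofList A)) e b →
      Den F ρ (.fix f x e) (.arr A b)
  | app {ρ : Interp} {e₁ e₂ : Exp} {A : List Token} {b : Token} :
      Den F ρ e₁ (.arr A b) → (∀ a ∈ A, Den F ρ e₂ a) → Den F ρ (.app e₁ e₂) b
  | var {ρ : Interp} {x : Var} {a : Token} : a ∈ ρ x → Den F ρ (.var x) a
  | unit {ρ : Interp} : Den F ρ .unit .unit
  | isPair {ρ : Interp} {e₁ e₂ : Exp} : Den F ρ (.pair e₁ e₂) .isPair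
  | comp_one {ρ : Interp} {e₁ e₂ : Exp} {a : Token} :
      Den F ρ e₁ a → Den F ρ (.pair e₁ e₂) (.comp .one a)
  | comp_two {ρ : Interp} {e₁ e₂ : Exp} {a : Token} :
      Den F ρ e₂ a → Den F ρ (.pair e₁ e₂) (.comp .two a)
  | prj {ρ : Interp} {i : Side} {e : Exp} {a : Token} :
      Den F ρ e (.comp i a) → Den F ρ (.prj i e) a
  | isCtor {ρ : Interp} {C : Con} {e : Exp} : Den F ρ (.ctor C e) (.isCtor C)
  | arg {ρ : Interp} {C : Con} {e : Exp} {a : Token} :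
      Den F ρ e a → Den F ρ (.ctor C e) (.arg C a)
  | case {ρ : Interp} {e e' : Exp} {bs : Branches} {C : Con} {x : Var} {Φ : List Token}
      {a : Token} :
      Den F ρ e (.isCtor C) → bs.lookup C = some (x, e') → (∀ t ∈ Φ, Den F ρ e (.arg C t)) →
      Den F (Function.update ρ x (ofList Φ)) e' a → Den F ρ (.case e bs) a
  | hole {ρ : Interp} {h : Hole} {e : Exp} {a : Token} :
      F.lookup h = some e → Den F ρ e a → Den F ρ (.hole h) a

/-- The denotation of an expression. -/
def denExp (F : Filling) (ρ : Interp) (e : Exp) : Set Token := {a | Den F ρ e a}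

/-- Application of denotations. -/
def appSem (d₁ d₂ : Set Token) : Set Token :=
  {b | ∃ A, Token.arr A b ∈ d₁ ∧ ∀ a ∈ A, a ∈ d₂}

/-- The components of a denotation. -/
def compSem (i : Side) (d : Set Token) : Set Token := {a | Token.comp i a ∈ d}

/-- The constructor argument of a denotation. -/
def argSem (C : Con) (d : Set Token) : Set Token := {a | Token.arg C a ∈ d}

/-- The denotation of a pair. -/
def pairSem (d₁ d₂ : Set Token) : Set Token :=
  {a | a = .isPair ∨ (∃ b ∈ d₁, a = .comp .one b) ∨ ∃ b ∈ d₂, a = .comp .two b}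

/-- The denotation of a constructor application. -/
def ctorSem (C : Con) (d : Set Token) : Set Token :=
  {a | a = .isCtor C ∨ ∃ b ∈ d, a = .arg C b}

/-- The denotation of a case expression with a scrutinee that denotes `d`. -/
def caseSem (F : Filling) (ρ : Interp) (d : Set Token) (bs : Branches) : Set Token :=
  {a | ∃ C x e, Token.isCtor C ∈ d ∧ bs.lookup C = some (x, e) ∧
    a ∈ denExp F (Function.update ρ x (argSem C d)) e}

-- Monotonicity and continuity of denotations

theorem update_mono {ρ ρ' : Interp} (h : ∀ x, ρ x ⊆ ρ' x) (y : Var) {d d' : Set Token}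
    (hd : d ⊆ d') (x : Var) : Function.update ρ y d x ⊆ Function.update ρ' y d' x := by
  by_cases hx : x = y
  · subst hx; simpa using hd
  · simpa [hx] using h x

theorem Den.mono {F : Filling} {ρ : Interp} {e : Exp} {a : Token} (h : Den F ρ e a) :
    ∀ {ρ' : Interp}, (∀ x, ρ x ⊆ ρ' x) → Den F ρ' e a := by
  induction h with
  | fix _ _ ih₁ ih₂ =>
    intro ρ' hρ
    exact .fix (fun t ht => ih₁ t ht hρ)
      (ih₂ (update_mono (update_mono hρ _ subset_rfl) _ subset_rfl))
  | app _ _ ih₁ ih₂ => intro ρ' hρ; exact .app (ih₁ hρ) fun a ha => ih₂ a ha hρ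
  | var h => intro ρ' hρ; exact .var (hρ _ h)
  | unit => intros; exact .unit
  | isPair => intros; exact .isPair
  | comp_one _ ih => intro ρ' hρ; exact .comp_one (ih hρ)
  | comp_two _ ih => intro ρ' hρ; exact .comp_two (ih hρ)
  | prj _ ih => intro ρ' hρ; exact .prj (ih hρ)
  | isCtor => intros; exact .isCtor
  | arg _ ih => intro ρ' hρ; exact .arg (ih hρ)
  | case _ hb _ _ ih₁ ih₂ ih₃ =>
    intro ρ' hρ
    exact .case (ih₁ hρ) hb (fun t ht => ih₂ t ht hρ) (ih₃ (update_mono hρ _ subset_rfl))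
  | hole hF _ ih => intro ρ' hρ; exact .hole hF (ih hρ)

/-- `L` is a finite approximation of `ρ`. -/
def Approx (L : Var → List Token) (ρ : Interp) : Prop := ∀ x, ∀ t ∈ L x, t ∈ ρ x

/-- The semantic environment given by finitely many tokens for each variable. -/
def finInterp (L : Var → List Token) : Interp := fun x => ofList (L x)

theorem Approx.append {L₁ L₂ : Var → List Token} {ρ : Interp} (h₁ : Approx L₁ ρ)
    (h₂ : Approx L₂ ρ) : Approx (fun x => L₁ x ++ L₂ x) ρ := by
  intro x t ht
  rcases List.mem_append.1 ht with h | h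
  exacts [h₁ x t h, h₂ x t h]

theorem finInterp_left (L₁ L₂ : Var → List Token) (x : Var) :
    finInterp L₁ x ⊆ finInterp (fun x => L₁ x ++ L₂ x) x :=
  fun _ h => List.mem_append_left _ h

theorem finInterp_right (L₁ L₂ : Var → List Token) (x : Var) :
    finInterp L₂ x ⊆ finInterp (fun x => L₁ x ++ L₂ x) x :=
  fun _ h => List.mem_append_right _ h

theorem approx_nil (ρ : Interp) : Approx (fun _ => []) ρ := fun _ _ h => by simp at h

/-- Finitely many approximations can be appended, and monotonicity carries each derivation over to
the result. The map `g` serves the premises of `Den.case`, which concern `.arg C t` in place of `t`.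
-/
theorem exists_approx_list {F : Filling} {ρ : Interp} {e : Exp} {g : Token → Token} :
    ∀ {Φ : List Token},
      (∀ t ∈ Φ, ∃ L, Approx L ρ ∧ Den F (finInterp L) e (g t)) →
      ∃ L, Approx L ρ ∧ ∀ t ∈ Φ, Den F (finInterp L) e (g t)
  | [], _ => ⟨_, approx_nil ρ, fun _ h => by simp at h⟩
  | t :: Φ, h => by
    obtain ⟨L₁, hL₁, h₁⟩ := h t (by simp)
    obtain ⟨L₂, hL₂, h₂⟩ := exists_approx_list (Φ := Φ) fun s hs => h s (by simp [hs])
    refine ⟨_, hL₁.append hL₂, fun s hs => ?_⟩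
    rcases List.mem_cons.1 hs with rfl | hs
    · exact h₁.mono (finInterp_left _ _)
    · exact (h₂ s hs).mono (finInterp_right _ _)

/-- Finite approximations of an updated semantic environment. -/
theorem Approx.split {L : Var → List Token} {ρ : Interp} {x : Var} {d : Set Token}
    (h : Approx L (Function.update ρ x d)) :
    Approx (Function.update L x []) ρ ∧ ofList (L x) ⊆ d ∧
      ∀ y, finInterp L y ⊆
        Function.update (finInterp (Function.update L x [])) x (ofList (L x)) y := by
  refine ⟨fun y t ht => ?_, fun t ht => ?_, fun y => ?_⟩
  · by_cases hy : y = x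
    · subst hy; simp at ht
    · simp only [Function.update_of_ne hy] at ht; simpa [hy] using h y t ht
  · simpa using h x t ht
  · by_cases hy : y = x
    · subst hy; simp [finInterp]
    · simp [hy, finInterp]

/-- Denotations are continuous in the semantic environment. -/
theorem Den.exists_approx {F : Filling} {ρ : Interp} {e : Exp} {a : Token} (h : Den F ρ e a) :
    ∃ L, Approx L ρ ∧ Den F (finInterp L) e a := by
  induction h with
  | @fix ρ f x e Φ A b _ _ ih₁ ih₂ =>
    obtain ⟨L₁, hL₁, h₁⟩ := exists_approx_list (g := id) ih₁
    obtain ⟨L₂, hL₂, h₂⟩ := ih₂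
    -- The tokens that the body uses at `x` lie in `A` and those at `f` in `Φ`, which the rule
    -- supplies anyway. Only the remaining ones have to be approximated in `ρ`.
    obtain ⟨hL₃, hx, hs⟩ := hL₂.split
    obtain ⟨hL₄, hf, hs'⟩ := hL₃.split
    refine ⟨_, hL₁.append hL₄, .fix (Φ := Φ)
      (fun t ht => (h₁ t ht).mono (finInterp_left _ _)) (h₂.mono fun y => ?_)⟩
    refine (hs y).trans (update_mono (fun z => (hs' z).trans ?_) x hx y)
    exact update_mono (fun w => finInterp_right _ _ w) f hf z
  | app _ _ ih₁ ih₂ =>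
    obtain ⟨L₁, hL₁, h₁⟩ := ih₁
    obtain ⟨L₂, hL₂, h₂⟩ := exists_approx_list (g := id) ih₂
    exact ⟨_, hL₁.append hL₂, .app (h₁.mono (finInterp_left _ _))
      fun a ha => (h₂ a ha).mono (finInterp_right _ _)⟩
  | @var ρ x a h =>
    refine ⟨Function.update (fun _ => []) x [a], fun y t ht => ?_, .var ?_⟩
    · by_cases hy : y = x
      · subst hy
        have : t = a := by simpa using ht
        exact this ▸ h
      · simp [hy] at ht
    · simp [finInterp, ofList]
  | @unit ρ => exact ⟨_, approx_nil ρ, .unit⟩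
  | @isPair ρ => exact ⟨_, approx_nil ρ, .isPair⟩
  | comp_one _ ih => obtain ⟨L, hL, h⟩ := ih; exact ⟨L, hL, .comp_one h⟩
  | comp_two _ ih => obtain ⟨L, hL, h⟩ := ih; exact ⟨L, hL, .comp_two h⟩
  | prj _ ih => obtain ⟨L, hL, h⟩ := ih; exact ⟨L, hL, .prj h⟩
  | @isCtor ρ => exact ⟨_, approx_nil ρ, .isCtor⟩
  | arg _ ih => obtain ⟨L, hL, h⟩ := ih; exact ⟨L, hL, .arg h⟩
  | @case ρ e e' bs C x Φ a _ hb _ _ ih₁ ih₂ ih₃ =>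
    obtain ⟨L₁, hL₁, h₁⟩ := ih₁
    obtain ⟨L₂, hL₂, h₂⟩ := exists_approx_list (g := .arg C) ih₂
    obtain ⟨L₃, hL₃, h₃⟩ := ih₃
    obtain ⟨hL₄, hx, hs⟩ := hL₃.split
    refine ⟨_, (hL₁.append hL₂).append hL₄, .case (Φ := Φ) (h₁.mono fun y => ?_) hb
      (fun t ht => (h₂ t ht).mono fun y => ?_) (h₃.mono fun y => ?_)⟩
    · exact (finInterp_left _ _ y).trans (finInterp_left _ _ y)
    · exact (finInterp_right _ _ y).trans (finInterp_left _ _ y)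
    · exact (hs y).trans (update_mono (finInterp_right _ _) x hx y)
  | hole hF _ ih => obtain ⟨L, hL, h⟩ := ih; exact ⟨L, hL, .hole hF h⟩

/-- Continuity in the denotation of one variable. -/
theorem Den.exists_list {F : Filling} {ρ : Interp} {x : Var} {d : Set Token} {e : Exp} {a : Token}
    (h : Den F (Function.update ρ x d) e a) :
    ∃ A : List Token, (∀ t ∈ A, t ∈ d) ∧ Den F (Function.update ρ x (ofList A)) e a := by
  obtain ⟨L, hL, h'⟩ := h.exists_approx
  obtain ⟨hρ, hd, hs⟩ := hL.split
  exact ⟨L x, hd, h'.mono fun y =>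
    (hs y).trans (update_mono (fun z t ht => hρ z t ht) x subset_rfl y)⟩

/-! Equations for denotations. -/

theorem denExp_hole {F : Filling} {h : Hole} {e : Exp} (hF : F.lookup h = some e) (ρ : Interp) :
    denExp F ρ (.hole h) = denExp F ρ e := by
  ext a
  constructor
  · intro ha
    cases ha with
    | hole hF' ha => rw [hF] at hF'; cases hF'; exact ha
  · exact fun ha => .hole hF ha

theorem denExp_hole_undefined {F : Filling} {h : Hole}
    (hF : F.lookup h = none ∨ F.lookup h = some (.hole h)) (ρ : Interp) :
    denExp F ρ (.hole h) = ∅ := by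
  -- A hole filled with itself has no tokens because a derivation is finite: its last step would
  -- need a shorter derivation for the same hole.
  have key : ∀ {ρ : Interp} {e : Exp} {a : Token}, Den F ρ e a → e ≠ .hole h := by
    intro ρ e a he
    induction he with
    | hole hF' _ ih =>
      rintro heq
      cases heq
      rcases hF with hF | hF
      · rw [hF] at hF'; cases hF'
      · rw [hF] at hF'; cases hF'; exact ih rfl
    | _ => simp
  exact Set.eq_empty_of_forall_notMem fun a ha => key ha rfl

theorem denExp_var (F : Filling) (ρ : Interp) (x : Var) : denExp F ρ (.var x) = ρ x := by
  ext a
  exact ⟨fun h => by cases h; assumption, .var⟩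

theorem denExp_unit (F : Filling) (ρ : Interp) : denExp F ρ .unit = {.unit} := by
  ext a
  exact ⟨fun h => by cases h; rfl, fun h => by cases h; exact .unit⟩

theorem denExp_pair (F : Filling) (ρ : Interp) (e₁ e₂ : Exp) :
    denExp F ρ (.pair e₁ e₂) = pairSem (denExp F ρ e₁) (denExp F ρ e₂) := by
  ext a
  constructor
  · intro h
    cases h with
    | isPair => exact .inl rfl
    | comp_one h => exact .inr (.inl ⟨_, h, rfl⟩)
    | comp_two h => exact .inr (.inr ⟨_, h, rfl⟩)
  · rintro (rfl | ⟨b, h, rfl⟩ | ⟨b, h, rfl⟩)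
    exacts [.isPair, .comp_one h, .comp_two h]

theorem denExp_ctor (F : Filling) (ρ : Interp) (C : Con) (e : Exp) :
    denExp F ρ (.ctor C e) = ctorSem C (denExp F ρ e) := by
  ext a
  constructor
  · intro h
    cases h with
    | isCtor => exact .inl rfl
    | arg h => exact .inr ⟨_, h, rfl⟩
  · rintro (rfl | ⟨b, h, rfl⟩)
    exacts [.isCtor, .arg h]

theorem denExp_app (F : Filling) (ρ : Interp) (e₁ e₂ : Exp) :
    denExp F ρ (.app e₁ e₂) = appSem (denExp F ρ e₁) (denExp F ρ e₂) := by
  ext a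
  constructor
  · intro h
    cases h with
    | app h₁ h₂ => exact ⟨_, h₁, h₂⟩
  · rintro ⟨A, h₁, h₂⟩
    exact .app h₁ h₂

theorem denExp_prj (F : Filling) (ρ : Interp) (i : Side) (e : Exp) :
    denExp F ρ (.prj i e) = compSem i (denExp F ρ e) := by
  ext a
  exact ⟨fun h => by cases h; assumption, .prj⟩

/-- Passing from the finite list in the rule to the whole argument is monotonicity; finding such a
list for a given token is continuity. -/
theorem denExp_case (F : Filling) (ρ : Interp) (e : Exp) (bs : Branches) :
    denExp F ρ (.case e bs) = caseSem F ρ (denExp F ρ e) bs := by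
  ext a
  constructor
  · intro h
    cases h with
    | case h₁ hb h₂ h₃ =>
      exact ⟨_, _, _, h₁, hb, h₃.mono (update_mono (fun _ => subset_rfl) _ fun t ht => h₂ t ht)⟩
  · rintro ⟨C, x, e', h₁, hb, h₂⟩
    obtain ⟨A, hA, h₃⟩ := Den.exists_list h₂
    exact .case h₁ hb hA h₃

/-- Beta reduction together with one unfolding of the recursion. It holds for every `d`, also the
empty set, so it does not matter whether the argument has a value. -/
theorem appSem_denExp_fix (F : Filling) (ρ : Interp) (f x : Var) (e : Exp) (d : Set Token) :
    appSem (denExp F ρ (.fix f x e)) d =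
      denExp F (Function.update (Function.update ρ f (denExp F ρ (.fix f x e))) x d) e := by
  ext b
  constructor
  · rintro ⟨A, h, hA⟩
    cases h with
    | fix h₁ h₂ =>
      exact h₂.mono (update_mono (update_mono (fun _ => subset_rfl) _ h₁) _ hA)
  · intro h
    obtain ⟨A, hA, h₁⟩ := Den.exists_list h
    -- Continuity is used a second time for the recursive variable: the tokens of `L` left at `f`
    -- after splitting off `x` form the list `Φ` of the rule.
    obtain ⟨L, hL, h₂⟩ := h₁.exists_approx
    obtain ⟨hL₃, hx, hs⟩ := hL.split
    obtain ⟨hL₄, hf, hs'⟩ := hL₃.split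
    refine ⟨A, .fix (Φ := _) hf (h₂.mono fun y => (hs y).trans ?_), hA⟩
    exact update_mono (fun z => (hs' z).trans (update_mono (fun w t ht => hL₄ w t ht) f
      subset_rfl z)) x hx y

@[simp] theorem compSem_one_pairSem (d₁ d₂ : Set Token) : compSem .one (pairSem d₁ d₂) = d₁ := by
  ext a; simp [compSem, pairSem]

@[simp] theorem compSem_two_pairSem (d₁ d₂ : Set Token) : compSem .two (pairSem d₁ d₂) = d₂ := by
  ext a; simp [compSem, pairSem]

@[simp] theorem argSem_ctorSem (C : Con) (d : Set Token) : argSem C (ctorSem C d) = d := by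
  ext a; simp [argSem, ctorSem]

theorem caseSem_of_isCtor {F : Filling} {ρ : Interp} {d : Set Token} {bs : Branches} {C : Con}
    {x : Var} {e : Exp} (hd : Token.isCtor C ∈ d) (hb : bs.lookup C = some (x, e)) :
    denExp F (Function.update ρ x (argSem C d)) e ⊆ caseSem F ρ d bs :=
  fun _ ha => ⟨C, x, e, hd, hb, ha⟩

theorem caseSem_ctorSem {F : Filling} {ρ : Interp} {d : Set Token} {bs : Branches} {C : Con}
    {x : Var} {e : Exp} (hb : bs.lookup C = some (x, e)) :
    caseSem F ρ (ctorSem C d) bs = denExp F (Function.update ρ x d) e := by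
  ext a
  constructor
  · rintro ⟨C', x', e', h, hb', ha⟩
    have : C' = C := by simpa [ctorSem] using h
    subst this
    rw [hb] at hb'
    cases hb'
    simpa using ha
  · intro ha
    exact ⟨C, x, e, .inl rfl, hb, by simpa using ha⟩

/-! Denotations of results. -/

mutual
  /-- The denotation of a result. -/
  def den (F : Filling) : Res → Set Token
    | .fix E f x e => denExp F (denEnv F E) (.fix f x e)
    | .unit => {.unit}
    | .pair r₁ r₂ => pairSem (den F r₁) (den F r₂)
    | .ctor C r => ctorSem C (den F r)
    | .hole E h => denExp F (denEnv F E) (.hole h)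
    | .app r₁ r₂ => appSem (den F r₁) (den F r₂)
    | .prj i r => compSem i (den F r)
    | .case E r bs => caseSem F (denEnv F E) (den F r) bs
    | .unwrap C r => argSem C (den F r)
  /-- The denotation of an environment. -/
  def denEnv (F : Filling) : Env → Interp
    | .nil => fun _ => ∅
    | .cons E x r => Function.update (denEnv F E) x (den F r)
end

theorem denEnv_of_lookup {F : Filling} {x : Var} {r : Res} :
    ∀ {E : Env}, E.lookup x = some r → denEnv F E x = den F r
  | .nil, h => by simp [Env.lookup] at h
  | .cons E y s, h => by
    by_cases hx : x = y
    · subst hx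
      have : s = r := by simpa [Env.lookup] using h
      simp [denEnv, this]
    · simp only [Env.lookup, hx, if_false] at h
      simp [denEnv, hx, denEnv_of_lookup h]

theorem appSem_den_fix (F : Filling) (E : Env) (f x : Var) (e : Exp) (r : Res) :
    appSem (den F (.fix E f x e)) (den F r) =
      denExp F (denEnv F (.cons (.cons E f (.fix E f x e)) x r)) e := by
  simp only [den, denEnv]
  exact appSem_denExp_fix ..

/-- Evaluation preserves denotations. -/
theorem Eval.den_eq {F : Filling} {E : Env} {e : Exp} {r : Res} (h : Eval E e r) :
    den F r = denExp F (denEnv F E) e := by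
  induction h with
  | hole => simp only [den]
  | fix => simp only [den]
  | var h => rw [denExp_var, denEnv_of_lookup h]
  | unit => rw [denExp_unit]; simp only [den]
  | pair _ _ ih₁ ih₂ => rw [denExp_pair, ← ih₁, ← ih₂]; simp only [den]
  | ctor _ ih => rw [denExp_ctor, ← ih]; simp only [den]
  | app _ _ _ ih₁ ih₂ ih₃ => rw [denExp_app, ← ih₁, ← ih₂, ih₃, appSem_den_fix]
  | app_indet _ _ _ ih₁ ih₂ => rw [denExp_app, ← ih₁, ← ih₂]; simp only [den]
  | prj_one _ ih => rw [denExp_prj, ← ih]; simp [den]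
  | prj_two _ ih => rw [denExp_prj, ← ih]; simp [den]
  | prj_indet _ _ ih => rw [denExp_prj, ← ih]; simp only [den]
  | case _ hb _ ih₁ ih₂ =>
    rw [denExp_case, ← ih₁, ih₂]
    simp only [den, denEnv]
    rw [caseSem_ctorSem hb]
  | case_indet _ _ ih => rw [denExp_case, ← ih]; simp only [den]

/-- The filling `F` extends the filling `G`. -/
def Filling.Extends (F G : Filling) : Prop := ∀ h e, G.lookup h = some e → F.lookup h = some e

theorem Filling.Extends.refl (F : Filling) : F.Extends F := fun _ _ h => h

theorem den_hole_of_lookup {F : Filling} {h : Hole} {e : Exp} (hF : F.lookup h = some e)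
    (E : Env) : den F (.hole E h) = denExp F (denEnv F E) e := by
  simp only [den]
  exact denExp_hole hF _

mutual
  /-- Resumption preserves denotations, also those under larger fillings. -/
  theorem Resume.den_eq {F G : Filling} (hG : F.Extends G) :
      ∀ {r r' : Res}, Resume G r r' → den F r = den F r'
    | _, _, .hole hF _ he hr => by
      rw [den_hole_of_lookup (hG _ _ hF), ← he.den_eq, Resume.den_eq hG hr]
    | _, _, .hole_indet _ hE => by simp only [den, ResumeEnv.den_eq hG hE]
    | _, _, .fix hE => by simp only [den, ResumeEnv.den_eq hG hE]
    | _, _, .unit => rfl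
    | _, _, .pair h₁ h₂ => by simp only [den, Resume.den_eq hG h₁, Resume.den_eq hG h₂]
    | _, _, .ctor h => by simp only [den, Resume.den_eq hG h]
    | _, _, .app h₁ h₂ he hr => by
      rw [← Resume.den_eq hG hr, he.den_eq, ← appSem_den_fix, ← Resume.den_eq hG h₁,
        ← Resume.den_eq hG h₂]
      simp only [den]
    | _, _, .app_indet h₁ h₂ _ => by
      simp only [den, Resume.den_eq hG h₁, Resume.den_eq hG h₂]
    | _, _, .prj_one h => by simp [den, Resume.den_eq hG h]
    | _, _, .prj_two h => by simp [den, Resume.den_eq hG h]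
    | _, _, .prj_indet h _ => by simp only [den, Resume.den_eq hG h]
    | _, _, .case h hb hE h₀ he hr => by
      rw [← Resume.den_eq hG hr, he.den_eq]
      simp only [den, denEnv, Resume.den_eq hG h, caseSem_ctorSem hb, ResumeEnv.den_eq hG hE,
        Resume.den_eq hG h₀]
    | _, _, .case_indet h _ hE => by
      simp only [den, Resume.den_eq hG h, ResumeEnv.den_eq hG hE]
    | _, _, .unwrap h => by simp [den, Resume.den_eq hG h]
    | _, _, .unwrap_indet h _ => by simp only [den, Resume.den_eq hG h]
  /-- Resumption of environments preserves denotations. -/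
  theorem ResumeEnv.den_eq {F G : Filling} (hG : F.Extends G) :
      ∀ {E E' : Env}, ResumeEnv G E E' → denEnv F E = denEnv F E'
    | _, _, .nil => rfl
    | _, _, .cons hE hr => by simp only [denEnv, ResumeEnv.den_eq hG hE, Resume.den_eq hG hr]
end

/-! ## Resumed results -/

/-- Resumed results: the components of a resumed result are resumed, and a resumed result that is
not headed by an introduction form denotes the empty set. -/
inductive Resumed (F : Filling) : Res → Prop
  | unit : Resumed F .unit
  | pair {r₁ r₂ : Res} : Resumed F r₁ → Resumed F r₂ → Resumed F (.pair r₁ r₂)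
  | ctor {C : Con} {r : Res} : Resumed F r → Resumed F (.ctor C r)
  | fix {E : Env} {f x : Var} {e : Exp} : Resumed F (.fix E f x e)
  | stuck {r : Res} : den F r = ∅ → Resumed F r

theorem Resumed.of_pair {F : Filling} {r₁ r₂ : Res} (h : Resumed F (.pair r₁ r₂)) :
    Resumed F r₁ ∧ Resumed F r₂ := by
  cases h with
  | pair h₁ h₂ => exact ⟨h₁, h₂⟩
  | stuck h =>
    have : Token.isPair ∈ den F (.pair r₁ r₂) := by simp [den, pairSem]
    simp [h] at this

theorem Resumed.of_ctor {F : Filling} {C : Con} {r : Res} (h : Resumed F (.ctor C r)) :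
    Resumed F r := by
  cases h with
  | ctor h => exact h
  | stuck h =>
    have : Token.isCtor C ∈ den F (.ctor C r) := by simp [den, ctorSem]
    simp [h] at this

/-- Functions have arrow tokens only, so any other token rules closures out. -/
theorem not_den_fix {F : Filling} {E : Env} {f x : Var} {e : Exp} {a : Token}
    (ha : a ∈ den F (.fix E f x e)) : ∃ A b, a = .arr A b := by
  simp only [den] at ha
  cases ha with
  | fix => exact ⟨_, _, rfl⟩

/-- Different introduction forms have disjoint sets of tokens and stuck results have none, so a
single token determines the head of a resumed result. The same reason gives `Resumed.eq_pair`,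
`Resumed.eq_ctor` and `Resumed.eq_fix`. -/
theorem Resumed.eq_unit {F : Filling} {r : Res} (h : Resumed F r) (ha : Token.unit ∈ den F r) :
    r = .unit := by
  cases h with
  | unit => rfl
  | pair => simp [den, pairSem] at ha
  | ctor => simp [den, ctorSem] at ha
  | fix => obtain ⟨A, b, h⟩ := not_den_fix ha; cases h
  | stuck h => simp [h] at ha

theorem Resumed.eq_pair {F : Filling} {r : Res} (h : Resumed F r)
    (ha : Token.isPair ∈ den F r ∨ ∃ i a, Token.comp i a ∈ den F r) :
    ∃ r₁ r₂, r = .pair r₁ r₂ := by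
  cases h with
  | unit => simp [den] at ha
  | pair => exact ⟨_, _, rfl⟩
  | ctor => simp [den, ctorSem] at ha
  | fix => rcases ha with ha | ⟨i, a, ha⟩ <;> obtain ⟨A, b, h⟩ := not_den_fix ha <;> cases h
  | stuck h => simp [h] at ha

theorem Resumed.eq_ctor {F : Filling} {r : Res} {C : Con} (h : Resumed F r)
    (ha : Token.isCtor C ∈ den F r ∨ ∃ a, Token.arg C a ∈ den F r) :
    ∃ r₀, r = .ctor C r₀ := by
  cases h with
  | unit => simp [den] at ha
  | pair => simp [den, pairSem] at ha
  | @ctor C' r₀ =>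
    have : C = C' := by
      rcases ha with ha | ⟨a, ha⟩ <;> simp [den, ctorSem] at ha
      exacts [ha, ha.2]
    exact ⟨r₀, by rw [this]⟩
  | fix => rcases ha with ha | ⟨a, ha⟩ <;> obtain ⟨A, b, h⟩ := not_den_fix ha <;> cases h
  | stuck h => simp [h] at ha

theorem Resumed.eq_fix {F : Filling} {r : Res} {A : List Token} {b : Token} (h : Resumed F r)
    (ha : Token.arr A b ∈ den F r) : ∃ E f x e, r = .fix E f x e := by
  cases h with
  | unit => simp [den] at ha
  | pair => simp [den, pairSem] at ha
  | ctor => simp [den, ctorSem] at ha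
  | fix => exact ⟨_, _, _, _, rfl⟩
  | stuck h => simp [h] at ha

/-- The outcome of a resumption is resumed. -/
theorem Resume.resumed {F : Filling} : ∀ {r r' : Res}, Resume F r r' → Resumed F r'
  | _, _, .hole _ _ _ hr => hr.resumed
  | _, _, .hole_indet hF _ => .stuck (by simp only [den]; exact denExp_hole_undefined hF _)
  | _, _, .fix _ => .fix
  | _, _, .unit => .unit
  | _, _, .pair h₁ h₂ => .pair h₁.resumed h₂.resumed
  | _, _, .ctor h => .ctor h.resumed
  | _, _, .app _ _ _ hr => hr.resumed
  | _, _, .app_indet h₁ _ hn => by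
    refine .stuck (Set.eq_empty_of_forall_notMem fun a ha => ?_)
    simp only [den] at ha
    obtain ⟨A, hA, _⟩ := ha
    -- A token of the application needs an arrow in the function part, which would then be a
    -- closure; but the application was paused for want of one. The other paused forms are treated
    -- likewise.
    obtain ⟨E, f, x, e, h⟩ := h₁.resumed.eq_fix hA
    exact hn _ _ _ _ h
  | _, _, .prj_one h => h.resumed.of_pair.1
  | _, _, .prj_two h => h.resumed.of_pair.2
  | _, _, .prj_indet h hn => by
    refine .stuck (Set.eq_empty_of_forall_notMem fun a ha => ?_)
    simp only [den] at ha
    obtain ⟨r₁, r₂, h⟩ := h.resumed.eq_pair (.inr ⟨_, _, ha⟩)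
    exact hn _ _ h
  | _, _, .case _ _ _ _ _ hr => hr.resumed
  | _, _, .case_indet h hn _ => by
    refine .stuck (Set.eq_empty_of_forall_notMem fun a ha => ?_)
    simp only [den] at ha
    obtain ⟨C, x, e, hC, hb, _⟩ := ha
    obtain ⟨r₀, h⟩ := h.resumed.eq_ctor (.inl hC)
    rw [hn _ _ h] at hb
    cases hb
  | _, _, .unwrap h => h.resumed.of_ctor
  | _, _, .unwrap_indet h hn => by
    refine .stuck (Set.eq_empty_of_forall_notMem fun a ha => ?_)
    simp only [den] at ha
    obtain ⟨r₀, h⟩ := h.resumed.eq_ctor (.inr ⟨_, ha⟩)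
    exact hn _ _ h

/-! ## Example satisfaction -/

/-- Satisfaction of an example by a denotation. -/
def Sat (F : Filling) : Ex → Set Token → Prop
  | .unit, d => Token.unit ∈ d
  | .pair ex₁ ex₂, d => Token.isPair ∈ d ∧ Sat F ex₁ (compSem .one d) ∧ Sat F ex₂ (compSem .two d)
  | .ctor C ex, d => Token.isCtor C ∈ d ∧ Sat F ex (argSem C d)
  | .inOut v ex, d => Sat F ex (appSem d (den F v.toRes))
  | .top, _ => True

/-- The denotation occurs only positively, for input-output examples in function position.
Monotonicity is needed because a chosen branch is only known to contribute a subset of what the case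
denotes. -/
theorem Sat.mono {F : Filling} :
    ∀ {ex : Ex} {d d' : Set Token}, Sat F ex d → d ⊆ d' → Sat F ex d'
  | .unit, _, _, h, hd => hd h
  | .pair _ _, _, _, h, hd =>
    ⟨hd h.1, h.2.1.mono fun _ ha => hd ha, h.2.2.mono fun _ ha => hd ha⟩
  | .ctor _ _, _, _, h, hd => ⟨hd h.1, h.2.mono fun _ ha => hd ha⟩
  | .inOut _ ex, _, _, h, hd =>
    Sat.mono (ex := ex) h fun _ ⟨A, hA, ha⟩ => ⟨A, hd hA, ha⟩
  | .top, _, _, _, _ => trivial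

theorem Downcast.toRes_eq {r : Res} {v : Val} (h : Downcast r v) : v.toRes = r := by
  induction h with
  | unit => rfl
  | pair _ _ ih₁ ih₂ => rw [Val.toRes, ih₁, ih₂]
  | ctor _ ih => rw [Val.toRes, ih]

/-- A resumed result that satisfies a simple value as an example is this value. -/
theorem Resumed.downcast {F : Filling} :
    ∀ {v : Val} {r : Res}, Resumed F r → Sat F v.toEx (den F r) → Downcast r v
  | .unit, r, h, hs => by
    rw [h.eq_unit hs]
    exact .unit
  | .pair v₁ v₂, r, h, hs => by
    obtain ⟨h₀, h₁, h₂⟩ := hs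
    obtain ⟨r₁, r₂, rfl⟩ := h.eq_pair (.inl h₀)
    simp only [den, compSem_one_pairSem, compSem_two_pairSem] at h₁ h₂
    exact .pair (h.of_pair.1.downcast h₁) (h.of_pair.2.downcast h₂)
  | .ctor C v, r, h, hs => by
    obtain ⟨h₀, h₁⟩ := hs
    obtain ⟨r₀, rfl⟩ := h.eq_ctor (.inl h₀)
    simp only [den, argSem_ctorSem] at h₁
    exact .ctor (h.of_ctor.downcast h₁)

/-! ## Constraint satisfaction -/

/-- A filling satisfies constraints if it extends their filling and the closures of their unfilled
holes satisfy the example constraints. -/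
def Constraints.Sat (F : Filling) (K : Constraints) : Prop :=
  F.Extends K.fill ∧ ∀ h X, K.unf.lookup h = some X →
    ∀ w ∈ X, Smyth.Sat F w.2 (den F (.hole w.1 h))

/-- The union of finite maps is biased to the left, so the second half relies on the agreement of
the two fillings. -/
theorem MergeFill.extends {F F₁ F₂ F₃ : Filling} (h : MergeFill F₁ F₂ F₃) (hF : F.Extends F₃) :
    F.Extends F₁ ∧ F.Extends F₂ := by
  obtain ⟨hc, rfl⟩ := h
  refine ⟨fun k e he => hF k e (Finmap.mem_lookup_union.2 (.inl he)), fun k e he => hF k e ?_⟩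
  by_cases hk : k ∈ F₁
  · obtain ⟨e', he'⟩ := Finmap.mem_iff.1 hk
    obtain rfl := hc k e' e he' he
    exact Finmap.mem_lookup_union.2 (.inl he')
  · exact Finmap.mem_lookup_union.2 (.inr ⟨hk, he⟩)

theorem MergeFill.extends_self {F F₁ F₂ F₃ : Filling} (h : MergeFill F₁ F₂ F₃)
    (h₁ : F.Extends F₁) (h₂ : F.Extends F₂) : F.Extends F₃ := by
  obtain ⟨-, rfl⟩ := h
  intro k e he
  rcases Finmap.mem_lookup_union.1 he with he | ⟨-, he⟩
  exacts [h₁ k e he, h₂ k e he]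

theorem MergeK.sat {F : Filling} {K₁ K₂ K : Constraints} (h : MergeK K₁ K₂ K) (hK : K.Sat F) :
    K₁.Sat F ∧ K₂.Sat F := by
  obtain ⟨hF, hU⟩ := h
  obtain ⟨h₁, h₂⟩ := hF.extends hK.1
  refine ⟨⟨h₁, fun k X hX w hw => ?_⟩, ⟨h₂, fun k X hX w hw => ?_⟩⟩
  · have := hU k
    rw [hX] at this
    cases h' : K₂.unf.lookup k with
    | none => rw [h'] at this; exact hK.2 k _ this w hw
    | some Y => rw [h'] at this; exact hK.2 k _ this w (.inl hw)
  · have := hU k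
    rw [hX] at this
    cases h' : K₁.unf.lookup k with
    | none => rw [h'] at this; exact hK.2 k _ this w hw
    | some Y => rw [h'] at this; exact hK.2 k _ this w (.inr hw)

theorem MergeList.sat {F : Filling} {Ks : List Constraints} {K : Constraints}
    (h : MergeList Ks K) (hK : K.Sat F) : ∀ K' ∈ Ks, K'.Sat F := by
  induction h with
  | nil => simp
  | cons _ hm ih =>
    intro K' hK'
    obtain ⟨h₁, h₂⟩ := hm.sat hK
    rcases List.mem_cons.1 hK' with rfl | hK'
    exacts [h₁, ih h₂ _ hK']

theorem exists_of_forall₂ {α β : Type*} {R : α → β → Prop} {l₁ : List α} {l₂ : List β}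
    (h : List.Forall₂ R l₁ l₂) : ∀ a ∈ l₁, ∃ b ∈ l₂, R a b := by
  induction h with
  | nil => simp
  | @cons a b _ _ hab _ ih =>
    intro c hc
    rcases List.mem_cons.1 hc with rfl | hc
    · exact ⟨b, by simp, hab⟩
    · obtain ⟨d, hd, hr⟩ := ih c hc
      exact ⟨d, by simp [hd], hr⟩

theorem exists_of_forall₂_right {α β : Type*} {R : α → β → Prop} {l₁ : List α} {l₂ : List β}
    (h : List.Forall₂ R l₁ l₂) : ∀ b ∈ l₂, ∃ a ∈ l₁, R a b :=
  exists_of_forall₂ (R := fun b a => R a b) h.flip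

/-! ## Soundness of unevaluation and of checking -/

mutual
  /-- Soundness of live unevaluation. -/
  theorem Uneval.sound {S : DataCtx} {Δ : HoleCtx} {F : Filling} :
      ∀ {G : Filling} {r : Res} {ex : Ex} {K : Constraints}, Uneval S Δ G r ex K →
        F.Extends G → K.Sat F → Sat F ex (den F r)
    | _, _, _, _, .top, _, _ => trivial
    | _, _, _, _, .unit, _, _ => by simp [Sat, den]
    | _, _, _, _, .pair h₁ h₂ hm, hG, hK => by
      obtain ⟨hK₁, hK₂⟩ := hm.sat hK
      refine ⟨by simp [den, pairSem], ?_, ?_⟩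
      · simpa [den] using h₁.sound hG hK₁
      · simpa [den] using h₂.sound hG hK₂
    | _, _, _, _, .ctor h, hG, hK =>
      ⟨by simp [den, ctorSem], by simpa [den] using h.sound hG hK⟩
    | _, _, _, _, .fix h, hG, hK => by
      simp only [Sat]
      -- The environment in which the body is checked is the one that arises when the closure is
      -- applied to `v`.
      rw [appSem_den_fix]
      exact h.sound hG hK _ (List.mem_singleton.2 rfl)
    | _, _, _, _, .hole, _, hK => hK.2 _ _ Finmap.lookup_singleton_eq _ rfl
    | _, _, _, _, .app hv h, hG, hK => by
      have := h.sound hG hK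
      rw [Sat, hv.toRes_eq] at this
      simpa only [den] using this
    | _, _, _, _, .prj_one h, hG, hK => by simpa only [den] using (h.sound hG hK).2.1
    | _, _, _, _, .prj_two h, hG, hK => by simpa only [den] using (h.sound hG hK).2.2
    | _, _, _, _, .case hb h₁ h₂ hm, hG, hK => by
      obtain ⟨hK₁, hK₂⟩ := hm.sat hK
      refine (h₂.sound hG hK₂ _ (List.mem_singleton.2 rfl)).mono ?_
      simp only [den, denEnv]
      -- The example `C ⊤` for the scrutinee yields just its head token. This selects the branch,
      -- whose variable is bound to `C⁻¹ r`, that is, to `argSem C` of the scrutinee.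
      exact caseSem_of_isCtor (h₁.sound hG hK₁).1 hb
    | _, _, _, _, .unwrap h, hG, hK => by simpa only [den] using (h.sound hG hK).2
    | _, _, _, _, .case_guess hb _ hF hr h hm, hG, hK => by
      obtain ⟨hK₁, hK₂⟩ := hm.sat hK
      -- The guessed filling is recorded in the output constraints, so `F` extends it and resumption
      -- under it is harmless.
      have hG' := hF.extends_self hG hK₁.1
      have := h.sound hG' hK₂ _ (List.mem_singleton.2 rfl)
      simp only [den, denEnv] at this ⊢
      rw [Resume.den_eq hG' hr]
      simp only [den]
      rwa [caseSem_ctorSem hb]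
  /-- Soundness of live bidirectional example checking. -/
  theorem Check.sound {S : DataCtx} {Δ : HoleCtx} {F : Filling} :
      ∀ {G : Filling} {e : Exp} {ws : List World} {K : Constraints}, Check S Δ G e ws K →
        F.Extends G → K.Sat F → ∀ w ∈ ws, Sat F w.2 (denExp F (denEnv F w.1) e)
    | _, _, _, _, .nil, _, _ => by simp
    | _, _, _, _, .cons ⟨r, he, hr⟩ hu hc hm, hG, hK => by
      obtain ⟨hK₁, hK₂⟩ := hm.sat hK
      intro w hw
      rcases List.mem_cons.1 hw with rfl | hw
      · rw [← he.den_eq, Resume.den_eq hG hr]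
        exact hu.sound hG hK₁
      · exact hc.sound hG hK₂ w hw
end

theorem CheckSet.sound {S : DataCtx} {Δ : HoleCtx} {F G : Filling} {e : Exp} {X : Set World}
    {K : Constraints} (h : CheckSet S Δ G e X K) (hG : F.Extends G) (hK : K.Sat F) :
    ∀ w ∈ X, Sat F w.2 (denExp F (denEnv F w.1) e) := by
  obtain ⟨ws, rfl, hc⟩ := h
  exact hc.sound hG hK

/-! ## Soundness of merging -/

/-- A filled hole denotes the same as its filler, so having checked the filler suffices. The
constraints of an unfilled hole are carried along unchanged. -/
theorem StepMerge.sound {S : DataCtx} {Δ : HoleCtx} {F : Filling} {K K' : Constraints}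
    (h : StepMerge S Δ K K') (hK : K'.Sat F) : K.Sat F := by
  obtain ⟨hs, Ks, K₀, -, hmem, hR, hL, hM⟩ := h
  obtain ⟨hF, hK₀⟩ := hM.sat hK
  refine ⟨hF.1, fun k X hX w hw => ?_⟩
  obtain ⟨Kh, hKh, X', hX', hr⟩ :=
    exists_of_forall₂ hR k ((hmem k).2 (Finmap.mem_iff.2 ⟨X, hX⟩))
  obtain rfl : X = X' := Option.some.inj (hX.symm.trans hX')
  have hsat := hL.sat hK₀ Kh hKh
  cases hr with
  | filled he hc =>
    rw [den_hole_of_lookup (hF.1 _ _ he)]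
    exact hc.sound hF.1 hsat w hw
  | unfilled => exact hsat.2 _ _ Finmap.lookup_singleton_eq w hw

theorem Merge.sound {S : DataCtx} {Δ : HoleCtx} {F : Filling} {K K' : Constraints}
    (h : Merge S Δ K K') (hK : K'.Sat F) : K.Sat F := by
  induction h with
  | step h _ _ ih => exact h.sound (ih hK)
  | done h _ => exact h.sound hK

/-! ## Soundness of hole synthesis -/

theorem lookup_toFinmap_map {α ι : Type*} {β : α → Type*} [DecidableEq α]
    {k : ι → α} {v : ∀ i, β (k i)} {l : List ι} (hl : (l.map k).Nodup) {i : ι} (hi : i ∈ l) :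
    (l.map fun j => (⟨k j, v j⟩ : Sigma β)).toFinmap.lookup (k i) = some (v i) := by
  rw [Finmap.dlookup_list_toFinmap]
  refine List.mem_dlookup ?_ (List.mem_map.2 ⟨i, hi, rfl⟩)
  simpa [List.NodupKeys, List.keys, Function.comp_def] using hl

theorem goalsUnf_lookup {G : List Goal} (hG : (G.map Goal.hole).Nodup) {g : Goal} (hg : g ∈ G) :
    (goalsUnf G).lookup g.hole = some g.worlds :=
  lookup_toFinmap_map (β := fun _ => Set World) (v := Goal.worlds) hG hg

theorem goalsCtx_lookup {G : List Goal} (hG : (G.map Goal.hole).Nodup) {g : Goal} (hg : g ∈ G) :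
    (goalsCtx G).lookup g.hole = some (g.ctx, g.ty) :=
  lookup_toFinmap_map (β := fun _ => Ctx × Ty) (k := Goal.hole) (v := fun g => (g.ctx, g.ty)) hG hg

/-- The closures of the holes of the goals satisfy their example constraints. -/
def GoalsSat (F : Filling) (G : List Goal) : Prop :=
  ∀ g ∈ G, ∀ w ∈ g.worlds, Sat F w.2 (denExp F (denEnv F w.1) (.hole g.hole))

theorem goalsSat_of_sat {F F' : Filling} {G : List Goal} (hG : (G.map Goal.hole).Nodup)
    (h : Constraints.Sat F ⟨F', goalsUnf G⟩) : GoalsSat F G := by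
  intro g hg w hw
  simpa only [den] using h.2 _ _ (goalsUnf_lookup hG hg) w hw

theorem Refine.nodup {S : DataCtx} {Δ : HoleCtx} {Γ : Ctx} {X : Set World} {T : Ty} {e : Exp}
    {G : List Goal} (h : Refine S Δ Γ X T e G) : (G.map Goal.hole).Nodup := by
  cases h <;> simp_all

theorem Branch.nodup {S : DataCtx} {Δ : HoleCtx} {F : Filling} {Γ : Ctx} {X : Set World} {T : Ty}
    {e : Exp} {G : List Goal} {K : Constraints} (h : Branch S Δ F Γ X T e G K) :
    (G.map Goal.hole).Nodup := by
  cases h with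
  | case _ _ _ _ _ _ _ hn => simpa [Function.comp_def] using hn

theorem sat_of_filterTop {F : Filling} {X : Set World} {d : Env → Set Token}
    (h : ∀ w ∈ filterTop X, Sat F w.2 (d w.1)) : ∀ w ∈ X, Sat F w.2 (d w.1) := by
  intro w hw
  by_cases ht : w.2 = .top
  · rw [ht]; trivial
  · exact h w ⟨hw, ht⟩

/-- The goals of the new holes describe exactly the components of the refined expression. For
functions this is `appSem_den_fix`, read from right to left. -/
theorem Refine.sound {S : DataCtx} {Δ : HoleCtx} {F : Filling} {Γ : Ctx} {X : Set World} {T : Ty}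
    {e : Exp} {G : List Goal} (h : Refine S Δ Γ X T e G) (hG : GoalsSat F G) :
    ∀ w ∈ X, Sat F w.2 (denExp F (denEnv F w.1) e) := by
  refine sat_of_filterTop (d := fun E => denExp F (denEnv F E) e) ?_
  rintro ⟨E, ex⟩ hw
  cases h with
  | unit hX =>
    obtain rfl : ex = .unit := hX _ hw
    simp [Sat, denExp_unit]
  | pair hX =>
    obtain ⟨ex₁, ex₂, rfl⟩ : ∃ ex₁ ex₂, ex = .pair ex₁ ex₂ := hX _ hw
    simp only [Sat, denExp_pair, compSem_one_pairSem, compSem_two_pairSem]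
    exact ⟨.inl rfl, hG _ (List.mem_cons_self ..) (E, ex₁) ⟨ex₂, hw⟩,
      hG _ (List.mem_cons_of_mem _ (List.mem_singleton.2 rfl)) (E, ex₂) ⟨ex₁, hw⟩⟩
  | ctor hX =>
    obtain ⟨ex', rfl⟩ : ∃ ex', ex = .ctor _ ex' := hX _ hw
    simp only [Sat, denExp_ctor, argSem_ctorSem]
    exact ⟨.inl rfl, hG _ (List.mem_singleton.2 rfl) (E, ex') hw⟩
  | @fix _ _ f x h₁ hX =>
    obtain ⟨v, ex', rfl⟩ : ∃ v ex', ex = .inOut v ex' := hX _ hw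
    have := hG _ (List.mem_singleton.2 rfl)
      (.cons (.cons E f (.fix E f x (.hole h₁))) x v.toRes, ex') ⟨E, v, hw, rfl⟩
    simp only [Sat]
    rw [← appSem_den_fix] at this
    simpa only [den] using this

/-- Lookup returns the first branch for `C`, which need not be the given one; hence the second
existential. -/
theorem lookup_holeBranches {C : Con} :
    ∀ {bs : List BranchSpec}, (∃ b ∈ bs, b.con = C) →
      ∃ b ∈ bs, b.con = C ∧ (holeBranches bs).lookup C = some (b.var, .hole b.hole)
  | [], h => by simp at h
  | b :: bs, h => by
    by_cases hb : b.con = C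
    · exact ⟨b, by simp, hb, by simp [holeBranches, Branches.lookup, hb]⟩
    · obtain ⟨b', hb', hC, hl⟩ := lookup_holeBranches (C := C) (bs := bs) (by simpa [hb] using h)
      exact ⟨b', by simp [hb'], hC, by simp [holeBranches, Branches.lookup, Ne.symm hb, hl]⟩

theorem den_collapse (F : Filling) (C : Con) (r : Res) :
    den F (collapse (.unwrap C r)) = argSem C (den F r) := by
  unfold collapse
  split
  · next h =>
    cases h
    split_ifs with hC
    · subst hC; simp [den]
    · simp only [den]
  · simp only [den]

theorem Branch.sound {S : DataCtx} {Δ : HoleCtx} {F G : Filling} {Γ : Ctx} {X : Set World}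
    {T : Ty} {e : Exp} {Gs : List Goal} {K : Constraints} (h : Branch S Δ G Γ X T e Gs K)
    (hF : F.Extends G) (hK : K.Sat F) (hG : GoalsSat F Gs) :
    ∀ w ∈ X, Sat F w.2 (denExp F (denEnv F w.1) e) := by
  refine sat_of_filterTop (d := fun E => denExp F (denEnv F E) e) ?_
  intro w hw
  cases h with
  | @case e₀ D cs ds Ks _ bs _ _ hX hds hL hcs _ _ =>
    rw [hX] at hw
    obtain ⟨d, hd, rfl⟩ := hw
    obtain ⟨Kd, hKd, he, hcon, hc⟩ := exists_of_forall₂ hds d hd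
    have hC := (hc.sound hF (hL.sat hK Kd hKd) _ (List.mem_singleton.2 rfl)).1
    obtain ⟨b, hb, hbC, hlk⟩ := lookup_holeBranches (C := d.con) (bs := bs) (by
      rw [← hcs] at hcon
      simpa using hcon)
    rw [denExp_case]
    refine Sat.mono ?_ (caseSem_of_isCtor hC hlk)
    -- The goal of `b` collects all examples assigned to its constructor, so the branch found by
    -- lookup received this one.
    have := hG _ (List.mem_map.2 ⟨b, hb, rfl⟩) _ ⟨d, hd, hbC.symm, rfl⟩
    simp only [denEnv, den_collapse, he.den_eq, hbC] at this
    exact this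

theorem lookup_of_sat_singleton {F : Filling} {h : Hole} {e : Exp} {U : Unfilled}
    (hK : Constraints.Sat F ⟨Finmap.singleton h e, U⟩) : F.lookup h = some e :=
  hK.1 h e Finmap.lookup_singleton_eq

/-- Soundness of hole synthesis: its output implies the example constraints of the goal. -/
theorem Fill.sound {S : DataCtx} {Δ Δ' : HoleCtx} {h : Hole} {F G : Filling} {Γ : Ctx}
    {X : Set World} {T : Ty} {K : Constraints} (hf : Fill S Δ h G Γ X T K Δ')
    (hF : F.Extends G) (hK : K.Sat F) : ∀ w ∈ X, Sat F w.2 (den F (.hole w.1 h)) := by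
  intro w hw
  cases hf with
  | guess_and_check _ hc hm =>
    obtain ⟨h₁, h₂⟩ := hm.sat hK
    have hh := lookup_of_sat_singleton h₁
    rw [den_hole_of_lookup hh]
    -- The check ran under `G` with `h` sent to `e`, possibly overriding an entry. `F` extends this
    -- filling because the output records `h ↦ e`.
    refine hc.sound (fun k e' hk => ?_) h₂ w hw
    by_cases hkh : k = h
    · subst hkh
      rw [Finmap.lookup_insert] at hk
      cases hk
      exact hh
    · rw [Finmap.lookup_insert_of_ne _ hkh] at hk
      exact hF k e' hk
  | defer _ hX => rw [hX w hw]; trivial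
  | refine hr =>
    rw [den_hole_of_lookup (lookup_of_sat_singleton hK)]
    exact hr.sound (goalsSat_of_sat hr.nodup hK) w hw
  | branch hb hm =>
    obtain ⟨h₁, h₂⟩ := hm.sat hK
    rw [den_hole_of_lookup (lookup_of_sat_singleton h₁)]
    exact hb.sound hF h₂ (goalsSat_of_sat hb.nodup h₁) w hw

-- Soundness of constraint solving and of assertion simplification

/-- Soundness of constraint solving. -/
theorem Solve.sound {S : DataCtx} {Δ Δ' : HoleCtx} {K : Constraints} {F : Filling}
    (h : Solve S Δ K F Δ') : K.Sat F := by
  induction h with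
  | done => exact ⟨Filling.Extends.refl _, fun h X hX => by simp at hX⟩
  | @one Δ Δ' Δ'' F F' U h Γ T X K K₀ K' _ hU hf hm hM _ ih =>
    obtain ⟨h₁, h₂⟩ := hm.sat (hM.sound ih)
    refine ⟨h₁.1, fun k Y hY w hw => ?_⟩
    -- The constraints of `h` were erased before merging; they are recovered from the soundness of
    -- hole synthesis.
    by_cases hk : k = h
    · subst hk
      obtain rfl : X = Y := Option.some.inj (hU.symm.trans hY)
      exact hf.sound h₁.1 h₂ w hw
    · exact h₁.2 k Y ((Finmap.lookup_erase_ne hk).trans hY) w hw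

/-- Soundness of assertion simplification. -/
theorem Simplify.sound {S : DataCtx} {Δ : HoleCtx} {F : Filling} {A : Assertions}
    {K : Constraints} (h : Simplify S Δ A K) (hK : K.Sat F) :
    ∀ a ∈ A, Sat F a.2.toEx (den F a.1) := by
  obtain ⟨Ks, hA, hL⟩ := h
  intro a ha
  obtain ⟨Ka, hKa, -, hu⟩ := exists_of_forall₂ hA a ha
  exact hu.sound (fun h e he => by simp at he) (hL.sat hK Ka hKa)

/-! ## Well-typed fillings -/

theorem FillingTy.empty (S : DataCtx) (Δ : HoleCtx) : FillingTy S Δ ∅ :=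
  fun h e he => by simp at he

theorem MergeFill.fillingTy {S : DataCtx} {Δ : HoleCtx} {F₁ F₂ F : Filling}
    (h : MergeFill F₁ F₂ F) (h₁ : FillingTy S Δ F₁) (h₂ : FillingTy S Δ F₂) :
    FillingTy S Δ F := by
  obtain ⟨-, rfl⟩ := h
  intro k e he
  rcases Finmap.mem_lookup_union.1 he with he | ⟨-, he⟩
  exacts [h₁ k e he, h₂ k e he]

theorem MergeList.fillingTy {S : DataCtx} {Δ : HoleCtx} {Ks : List Constraints}
    {K : Constraints} (h : MergeList Ks K) (hKs : ∀ K' ∈ Ks, FillingTy S Δ K'.fill) :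
    FillingTy S Δ K.fill := by
  induction h with
  | nil => exact .empty S Δ
  | cons _ hm ih =>
    exact hm.1.fillingTy (hKs _ (by simp)) (ih fun K' hK' => hKs _ (by simp [hK']))

mutual
  -- Only a guess for a case closure puts anything into the filling of the output, and guesses are
  -- well typed.
  theorem Uneval.fillingTy {S : DataCtx} {Δ : HoleCtx} :
      ∀ {G : Filling} {r : Res} {ex : Ex} {K : Constraints}, Uneval S Δ G r ex K →
        FillingTy S Δ K.fill
    | _, _, _, _, .top => .empty S Δ
    | _, _, _, _, .unit => .empty S Δ
    | _, _, _, _, .pair h₁ h₂ hm => hm.1.fillingTy h₁.fillingTy h₂.fillingTy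
    | _, _, _, _, .ctor h => h.fillingTy
    | _, _, _, _, .fix h => h.fillingTy
    | _, _, _, _, .hole => .empty S Δ
    | _, _, _, _, .app _ h => h.fillingTy
    | _, _, _, _, .prj_one h => h.fillingTy
    | _, _, _, _, .prj_two h => h.fillingTy
    | _, _, _, _, .case _ h₁ h₂ hm => hm.1.fillingTy h₁.fillingTy h₂.fillingTy
    | _, _, _, _, .unwrap h => h.fillingTy
    | _, _, _, _, .case_guess _ hg _ _ h hm => hm.1.fillingTy hg h.fillingTy
  theorem Check.fillingTy {S : DataCtx} {Δ : HoleCtx} :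
      ∀ {G : Filling} {e : Exp} {ws : List World} {K : Constraints}, Check S Δ G e ws K →
        FillingTy S Δ K.fill
    | _, _, _, _, .nil => .empty S Δ
    | _, _, _, _, .cons _ hu hc hm => hm.1.fillingTy hu.fillingTy hc.fillingTy
end

theorem Merge.fillingTy {S : DataCtx} {Δ : HoleCtx} {K K' : Constraints}
    (h : Merge S Δ K K') (hK : FillingTy S Δ K.fill) : FillingTy S Δ K'.fill := by
  have step : ∀ {K K' : Constraints}, StepMerge S Δ K K' → FillingTy S Δ K.fill →
      FillingTy S Δ K'.fill := by
    rintro K K' ⟨hs, Ks, K₀, -, -, hR, hL, hM⟩ hK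
    refine hM.1.fillingTy hK (hL.fillingTy fun Kh hKh => ?_)
    obtain ⟨k, -, X, -, hr⟩ := exists_of_forall₂_right hR Kh hKh
    cases hr with
    | filled _ hc => exact hc.choose_spec.2.fillingTy
    | unfilled => exact .empty S Δ
  induction h with
  | step h _ _ ih => exact ih (step h hK)
  | done h _ => exact step h hK

-- Weakening of the hole context and typing of synthesized fillings

mutual
  theorem HasTy.mono {S : DataCtx} {Δ Δ' : HoleCtx}
      (hΔ : ∀ h c, Δ.lookup h = some c → Δ'.lookup h = some c) :
      ∀ {Γ : Ctx} {e : Exp} {T : Ty}, HasTy S Δ Γ e T → HasTy S Δ' Γ e T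
    | _, _, _, .fix h => .fix (h.mono hΔ)
    | _, _, _, .var h => .var h
    | _, _, _, .hole h => .hole (hΔ _ _ h)
    | _, _, _, .unit => .unit
    | _, _, _, .pair h₁ h₂ => .pair (h₁.mono hΔ) (h₂.mono hΔ)
    | _, _, _, .ctor hC h => .ctor hC (h.mono hΔ)
    | _, _, _, .app h₁ h₂ => .app (h₁.mono hΔ) (h₂.mono hΔ)
    | _, _, _, .prj_one h => .prj_one (h.mono hΔ)
    | _, _, _, .prj_two h => .prj_two (h.mono hΔ)
    | _, _, _, .case h hD hb => .case (h.mono hΔ) hD (hb.mono hΔ)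
  theorem BranchesTy.mono {S : DataCtx} {Δ Δ' : HoleCtx}
      (hΔ : ∀ h c, Δ.lookup h = some c → Δ'.lookup h = some c) :
      ∀ {Γ : Ctx} {T : Ty} {cs : List (Con × Ty)} {bs : Branches},
        BranchesTy S Δ Γ T cs bs → BranchesTy S Δ' Γ T cs bs
    | _, _, _, _, .nil => .nil
    | _, _, _, _, .cons h hb => .cons (h.mono hΔ) (hb.mono hΔ)
end

mutual
  -- Guessed expressions contain no holes, hence any hole context will do.
  theorem Guess.hasTy {S : DataCtx} (Δ : HoleCtx) :
      ∀ {Γ : Ctx} {T : Ty} {e : Exp}, Guess S Γ T e → HasTy S Δ Γ e T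
    | _, _, _, .fix h => .fix (h.hasTy Δ)
    | _, _, _, .var h => .var h
    | _, _, _, .unit => .unit
    | _, _, _, .pair h₁ h₂ => .pair (h₁.hasTy Δ) (h₂.hasTy Δ)
    | _, _, _, .ctor hC h => .ctor hC (h.hasTy Δ)
    | _, _, _, .app h₁ h₂ => .app (h₁.hasTy Δ) (h₂.hasTy Δ)
    | _, _, _, .prj_one h => .prj_one (h.hasTy Δ)
    | _, _, _, .prj_two h => .prj_two (h.hasTy Δ)
    | _, _, _, .case hD h hb => .case (h.hasTy Δ) hD (hb.branchesTy Δ)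
  theorem GuessBranches.branchesTy {S : DataCtx} (Δ : HoleCtx) :
      ∀ {Γ : Ctx} {T : Ty} {cs : List (Con × Ty)} {bs : Branches},
        GuessBranches S Γ T cs bs → BranchesTy S Δ Γ T cs bs
    | _, _, _, _, .nil => .nil
    | _, _, _, _, .cons h hb => .cons (h.hasTy Δ) (hb.branchesTy Δ)
end

theorem lookup_union_mono {Δ Δ' : HoleCtx} (h : Hole) (c : Ctx × Ty)
    (hc : Δ.lookup h = some c) : (Δ ∪ Δ').lookup h = some c :=
  Finmap.mem_lookup_union.2 (.inl hc)

theorem FillingTy.union {S : DataCtx} {Δ Δ' : HoleCtx} {F : Filling} (hF : FillingTy S Δ F) :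
    FillingTy S (Δ ∪ Δ') F := by
  intro h e he
  obtain ⟨Γ, T, hΔ, ht⟩ := hF h e he
  exact ⟨Γ, T, lookup_union_mono _ _ hΔ, ht.mono lookup_union_mono⟩

/-- Freshness keeps the left-biased union from returning an older type for the hole, and
distinctness keeps the goals from shadowing one another. -/
theorem hasTy_goal {S : DataCtx} {Δ : HoleCtx} {G : List Goal} (hG : (G.map Goal.hole).Nodup)
    {g : Goal} (hg : g ∈ G) (hΔ : g.hole ∉ Δ) :
    HasTy S (Δ ∪ goalsCtx G) g.ctx (.hole g.hole) g.ty :=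
  .hole (Finmap.mem_lookup_union.2 (.inr ⟨hΔ, goalsCtx_lookup hG hg⟩))

theorem Refine.hasTy {S : DataCtx} {Δ : HoleCtx} {Γ : Ctx} {X : Set World} {T : Ty} {e : Exp}
    {G : List Goal} (h : Refine S Δ Γ X T e G) : HasTy S (Δ ∪ goalsCtx G) Γ e T := by
  have hn := h.nodup
  cases h with
  | unit => exact .unit
  | pair _ h₁ h₂ =>
    exact .pair (hasTy_goal hn (List.mem_cons_self ..) h₁)
      (hasTy_goal hn (List.mem_cons_of_mem _ (List.mem_singleton.2 rfl)) h₂)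
  | ctor _ hC h₁ => exact .ctor hC (hasTy_goal hn (List.mem_singleton.2 rfl) h₁)
  | fix _ h₁ => exact .fix (hasTy_goal hn (List.mem_singleton.2 rfl) h₁)

theorem branchesTy_holeBranches {S : DataCtx} {Δ : HoleCtx} {Γ : Ctx} {T : Ty} :
    ∀ {bs : List BranchSpec},
      (∀ b ∈ bs, HasTy S Δ ((b.var, b.ty) :: Γ) (.hole b.hole) T) →
      BranchesTy S Δ Γ T (bs.map fun b => (b.con, b.ty)) (holeBranches bs)
  | [], _ => .nil
  | b :: bs, h => .cons (h b (by simp))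
      (branchesTy_holeBranches (bs := bs) fun b' hb' => h b' (by simp [hb']))

theorem Branch.hasTy {S : DataCtx} {Δ : HoleCtx} {F : Filling} {Γ : Ctx} {X : Set World} {T : Ty}
    {e : Exp} {G : List Goal} {K : Constraints} (h : Branch S Δ F Γ X T e G K) :
    HasTy S (Δ ∪ goalsCtx G) Γ e T := by
  have hn := h.nodup
  cases h with
  | case hD hg _ _ _ hcs hfresh _ =>
    subst hcs
    exact .case (hg.hasTy _) hD (branchesTy_holeBranches fun b hb =>
      hasTy_goal hn (List.mem_map.2 ⟨b, hb, rfl⟩) (hfresh b hb))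

theorem Branch.fillingTy {S : DataCtx} {Δ : HoleCtx} {F : Filling} {Γ : Ctx} {X : Set World}
    {T : Ty} {e : Exp} {G : List Goal} {K : Constraints} (h : Branch S Δ F Γ X T e G K) :
    FillingTy S Δ K.fill := by
  cases h with
  | case _ _ _ hds hL _ _ _ =>
    refine hL.fillingTy fun K' hK' => ?_
    obtain ⟨d, -, -, -, hc⟩ := exists_of_forall₂_right hds K' hK'
    exact hc.fillingTy

theorem FillingTy.singleton {S : DataCtx} {Δ : HoleCtx} {h : Hole} {e : Exp} {Γ : Ctx} {T : Ty}
    (hΔ : Δ.lookup h = some (Γ, T)) (he : HasTy S Δ Γ e T) :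
    FillingTy S Δ (Finmap.singleton h e) := by
  intro k e' hk
  obtain rfl : k = h := (Finmap.mem_singleton _ _ _).1 (Finmap.mem_iff.2 ⟨_, hk⟩)
  rw [Finmap.lookup_singleton_eq] at hk
  cases hk
  exact ⟨Γ, T, hΔ, he⟩

/-- Hole synthesis yields well-typed fillings. -/
theorem Fill.fillingTy {S : DataCtx} {Δ Δ' : HoleCtx} {h : Hole} {F : Filling} {Γ : Ctx}
    {X : Set World} {T : Ty} {K : Constraints} (hf : Fill S Δ h F Γ X T K Δ')
    (hΔ : Δ.lookup h = some (Γ, T)) : FillingTy S (Δ ∪ Δ') K.fill := by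
  cases hf with
  | guess_and_check hg hc hm =>
    exact hm.1.fillingTy (.singleton (lookup_union_mono _ _ hΔ) (hg.hasTy _))
      hc.choose_spec.2.fillingTy.union
  | defer =>
    exact .singleton (lookup_union_mono _ _ hΔ) (.hole (lookup_union_mono _ _ hΔ))
  | refine hr => exact .singleton (lookup_union_mono _ _ hΔ) hr.hasTy
  | branch hb hm =>
    exact hm.1.fillingTy (.singleton (lookup_union_mono _ _ hΔ) hb.hasTy) hb.fillingTy.union

/-- Constraint solving yields well-typed fillings. -/
theorem Solve.fillingTy {S : DataCtx} {Δ Δ' : HoleCtx} {K : Constraints} {F : Filling}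
    (h : Solve S Δ K F Δ') (hK : FillingTy S Δ K.fill) : FillingTy S Δ' F := by
  induction h with
  | done => exact hK
  | one hΔ _ hf hm hM _ ih =>
    exact ih (hM.fillingTy (hm.1.fillingTy hK.union (hf.fillingTy hΔ)))

theorem Simplify.fillingTy {S : DataCtx} {Δ : HoleCtx} {A : Assertions} {K : Constraints}
    (h : Simplify S Δ A K) : FillingTy S Δ K.fill := by
  obtain ⟨Ks, hA, hL⟩ := h
  refine hL.fillingTy fun K' hK' => ?_
  obtain ⟨a, -, -, hu⟩ := exists_of_forall₂_right hA K' hK'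
  exact hu.fillingTy

end Smyth

open Smyth
theorem mainTheorem1 (S : DataCtx) (Δ Δ' : HoleCtx) (p : Program) (T T' : Ty) (r : Res)
    (A : Assertions) (K : Constraints) (F : Filling)
    (hp : ProgramTy S Δ p T T') (hA : ProgramEval p r A)
    (hK : Simplify S Δ A K) (hF : Solve S Δ K F Δ') :
    FillingTy S Δ' F ∧ (ResumptionTotal F A → AssertionSat F A) := by
  refine ⟨hF.fillingTy hK.fillingTy, fun htot a ha => ?_⟩
  obtain ⟨r', hr⟩ := htot a ha
  refine ⟨r', hr, hr.resumed.downcast ?_⟩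
  -- Satisfaction is known for the asserted result and is moved to its outcome, which has the same
  -- denotation.
  rw [← Resume.den_eq (Filling.Extends.refl F) hr]
  exact hK.sound hF.sound a ha
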